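/- **Theorem.** Let $\mathcal H$ be the arrangement of the seven planes in $\mathbb R^3$ through the origin with normal vectors $(1,0,0),(0,1,0),(0,0,1),(1,1,0),(0,1,1),(1,0,1),(1,1,1)$, i.e. all nonzero $0/1$-vectors. Let $\Sigma_{\mathcal H}$ be its fan (a finite complete simplicial fan), let $\mathfrak P_{\mathrm{flat}}$ be the flat-partition of $\Sigma_{\mathcal H}$, which identifies two cones iff the smallest intersections of planes of $\mathcal H$ containing them coincide, let $B$ be an arbitrary region (maximal cone) of $\mathcal H$, and let $\mathcal P$ be the poset of regions with base region $B$ (regions ordered by inclusion of the sets of planes separating them from $B$). Then the functor $$\Psi:\mathfrak C(\Sigma_{\mathcal H},\mathfrak P_{\mathrm{flat}})\to G(\Sigma_{\mathcal H},\mathfrak P_{\mathrm{flat}},\mathcal P),\qquad [f_{\sigma\kappa}]\mapsto X_{[\sigma^-,\kappa^-]},$$ to the picture group, viewed as a category with one object, is faithful. Here, for a cone $\sigma$, $\pi_\sigma$ is the orthogonal projection onto $\operatorname{span}(\sigma)^\perp$. The category $\mathfrak C(\Sigma,\mathfrak P)$ has as objects the blocks $[\sigma]$ of $\mathfrak P$;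 the morphisms $[\sigma]\to[\tau]$ are the classes $[f_{\sigma_1\tau_1}]$ of inclusions $\sigma_1\subseteq\tau_1$ with $\sigma_1\in[\sigma]$, $\tau_1\in[\tau]$, where $f_{\sigma_1\tau_1}\sim f_{\sigma_2\tau_2}$ iff $\pi_{\sigma_1}(\tau_1)=\pi_{\sigma_2}(\tau_2)$; composition is $[f_{\kappa\tau}]\circ[f_{\sigma\kappa}]=[f_{\sigma\tau}]$. For a cone $\sigma$, the maximal cones containing $\sigma$ form an interval $[\sigma^-,\sigma^+]$ of $\mathcal P$. Each arrow $\tau_1\to\tau_2$ of the Hasse diagram ($\tau_1$ covers $\tau_2$) is labelled by the codimension-one cone $\tau_1\cap\tau_2$. The picture group $G(\Sigma,\mathfrak P,\mathcal P)$ has one generator $X_{[\sigma]}$ for each block of codimension-one cones, and relations: (1) $X_{[\sigma_1]}\cdots X_{[\sigma_k]}=X_{[\sigma_1']}\cdots X_{[\sigma_\ell']}$ whenever $(\sigma_1,\dots,\sigma_k)$ and $(\sigma'_1,\dots,\sigma'_\ell)$ label two maximal chains, read from top to bottom, of the same interval $[\rho,\tau]$, the common value being denoted $X_{[\rho,\tau]}$;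 (2) $X_{[\sigma_1^-,\kappa_1^-]}=X_{[\sigma_2^-,\kappa_2^-]}$ whenever $[f_{\sigma_1\kappa_1}]=[f_{\sigma_2\kappa_2}]$ in $\mathfrak C(\Sigma,\mathfrak P)$. -/

import Mathlib

open CategoryTheory

noncomputable section

namespace PicGroup

/-- Euclidean space of dimension `n`. -/
abbrev E (n : ℕ) := EuclideanSpace ℝ (Fin n)

/-! ### Cones and fans -/

/-- The linear span of a cone. -/
def cspan {n : ℕ} (σ : PointedCone ℝ (E n)) : Submodule ℝ (E n) :=
  Submodule.span ℝ (σ : Set (E n))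

/-- The dimension of a cone is the dimension of its linear span. -/
def cdim {n : ℕ} (σ : PointedCone ℝ (E n)) : ℕ := Module.finrank ℝ (cspan σ)

/-- `F` is a face of `σ`: the intersection of `σ` with a hyperplane `u^⊥`, where the linear form
`⟨u, ·⟩` is nonnegative on `σ`. -/
def IsFace {n : ℕ} (F σ : PointedCone ℝ (E n)) : Prop :=
  ∃ u : E n, (∀ w ∈ σ, 0 ≤ inner ℝ u w) ∧ ∀ v, v ∈ F ↔ v ∈ σ ∧ inner ℝ u v = 0

/-- A (simplicial) fan in `ℝⁿ`. A simplicial cone is generated by a finite linearly independent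
set; such a cone is automatically polyhedral and strongly convex. -/
structure Fan (n : ℕ) where
  cones : Set (PointedCone ℝ (E n))
  simplicial : ∀ σ ∈ cones, σ.IsSimplicial
  face_mem : ∀ σ ∈ cones, ∀ F, IsFace F σ → F ∈ cones
  inter_face : ∀ σ ∈ cones, ∀ τ ∈ cones, IsFace (σ ⊓ τ) σ ∧ IsFace (σ ⊓ τ) τ

/-- The cones of a fan, ordered by inclusion. -/
abbrev Fan.Cone {n : ℕ} (F : Fan n) := {σ : PointedCone ℝ (E n) // σ ∈ F.cones}

/-- The image `π_σ(τ)` of `τ` under the orthogonal projection `π_σ : ℝⁿ → span(σ)^⊥`. -/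
def proj {n : ℕ} (σ τ : PointedCone ℝ (E n)) : Set (E n) :=
  (cspan σ)ᗮ.starProjection '' (τ : Set (E n))

/-- The projected star `π_σ(star σ)`, a collection of subsets of `span(σ)^⊥`. -/
def Fan.projStar {n : ℕ} (F : Fan n) (σ : PointedCone ℝ (E n)) : Set (Set (E n)) :=
  proj σ '' {τ | τ ∈ F.cones ∧ σ ≤ τ}

/-- An admissible partition of a fan, given as an equivalence relation on its cones:
only potential identifications are made, and identified cones have their stars identified. -/
structure AdmissiblePartition {n : ℕ} (F : Fan n) where
  rel : Setoid F.Cone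
  perp_eq : ∀ σ₁ σ₂ : F.Cone, rel σ₁ σ₂ → (cspan σ₁.1)ᗮ = (cspan σ₂.1)ᗮ
  projStar_eq : ∀ σ₁ σ₂ : F.Cone, rel σ₁ σ₂ → F.projStar σ₁.1 = F.projStar σ₂.1
  admissible : ∀ σ₁ σ₂ τ₁ τ₂ : F.Cone, rel σ₁ σ₂ → σ₁ ≤ τ₁ → σ₂ ≤ τ₂ →
    proj σ₁.1 τ₁.1 = proj σ₂.1 τ₂.1 → rel τ₁ τ₂

/-! ### The category of a partitioned fan -/

theorem cspan_eq_of_perp {n : ℕ} {σ₁ σ₂ : PointedCone ℝ (E n)}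
    (h : (cspan σ₁)ᗮ = (cspan σ₂)ᗮ) : cspan σ₁ = cspan σ₂ := by
  rw [← Submodule.orthogonal_orthogonal (cspan σ₁), h, Submodule.orthogonal_orthogonal]

theorem subset_cspan {n : ℕ} {σ : PointedCone ℝ (E n)} {x : E n} (hx : x ∈ σ) : x ∈ cspan σ :=
  Submodule.subset_span hx

theorem cspan_mono {n : ℕ} {σ τ : PointedCone ℝ (E n)} (h : σ ≤ τ) : cspan σ ≤ cspan τ :=
  Submodule.span_mono h

theorem starProj_eq_iff {n : ℕ} (U : Submodule ℝ (E n)) (x y : E n) :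
    Uᗮ.starProjection x = Uᗮ.starProjection y ↔ x - y ∈ U := by
  rw [← sub_eq_zero, ← map_sub, Submodule.starProjection_orthogonal]
  simp only [sub_apply, ContinuousLinearMap.id_apply]
  rw [sub_eq_zero, eq_comm]
  exact Submodule.starProjection_eq_self_iff

theorem proj_eq_iff {n : ℕ} {σ₁ σ₂ : PointedCone ℝ (E n)} (h : cspan σ₁ = cspan σ₂)
    (τ₁ τ₂ : PointedCone ℝ (E n)) :
    proj σ₁ τ₁ = proj σ₂ τ₂ ↔
      (∀ x ∈ τ₁, ∃ y ∈ τ₂, x - y ∈ cspan σ₂) ∧ (∀ y ∈ τ₂, ∃ x ∈ τ₁, x - y ∈ cspan σ₂) := by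
  have h0 : proj σ₁ τ₁ = proj σ₂ τ₁ := by
    unfold proj
    simp only [h]
  rw [h0]
  unfold proj
  constructor
  · intro e
    constructor
    · intro x hx
      have : (cspan σ₂)ᗮ.starProjection x ∈ (cspan σ₂)ᗮ.starProjection '' (τ₂ : Set (E n)) := by
        rw [← e]; exact ⟨x, hx, rfl⟩
      obtain ⟨y, hy, hxy⟩ := this
      exact ⟨y, hy, (starProj_eq_iff _ _ _).1 hxy.symm⟩
    · intro y hy
      have : (cspan σ₂)ᗮ.starProjection y ∈ (cspan σ₂)ᗮ.starProjection '' (τ₁ : Set (E n)) := by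
        rw [e]; exact ⟨y, hy, rfl⟩
      obtain ⟨x, hx, hxy⟩ := this
      exact ⟨x, hx, (starProj_eq_iff _ _ _).1 hxy⟩
  · rintro ⟨h1, h2⟩
    ext z
    constructor
    · rintro ⟨x, hx, rfl⟩
      obtain ⟨y, hy, hxy⟩ := h1 x hx
      exact ⟨y, hy, ((starProj_eq_iff _ _ _).2 hxy).symm⟩
    · rintro ⟨y, hy, rfl⟩
      obtain ⟨x, hx, hxy⟩ := h2 y hy
      exact ⟨x, hx, (starProj_eq_iff _ _ _).2 hxy⟩

theorem mem_cspan_iff {n : ℕ} (σ : PointedCone ℝ (E n)) (x : E n) :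
    x ∈ cspan σ → ∃ a ∈ σ, ∃ b ∈ σ, x = a - b := by
  intro hx
  unfold cspan at hx
  induction hx using Submodule.span_induction with
  | mem x h => exact ⟨x, h, 0, σ.zero_mem, by simp⟩
  | zero => exact ⟨0, σ.zero_mem, 0, σ.zero_mem, by simp⟩
  | add x y _ _ hx hy =>
    obtain ⟨a, ha, b, hb, rfl⟩ := hx
    obtain ⟨c, hc, d, hd, rfl⟩ := hy
    exact ⟨a + c, σ.add_mem ha hc, b + d, σ.add_mem hb hd, by abel⟩
  | smul r x _ hx =>
    obtain ⟨a, ha, b, hb, rfl⟩ := hx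
    rcases le_total 0 r with hr | hr
    · exact ⟨r • a, PointedCone.smul_mem σ hr ha, r • b, PointedCone.smul_mem σ hr hb,
        smul_sub r a b⟩
    · refine ⟨(-r) • b, PointedCone.smul_mem σ (by linarith) hb, (-r) • a,
        PointedCone.smul_mem σ (by linarith) ha, ?_⟩
      simp only [neg_smul, smul_sub]; abel

theorem Fan.mem_of_sub_mem {n : ℕ} (F : Fan n) {κ τ₁ τ₂ : F.Cone} (h1 : κ ≤ τ₁) (h2 : κ ≤ τ₂)
    {x y : E n} (hx : x ∈ τ₁.1) (hy : y ∈ τ₂.1) (hxy : x - y ∈ cspan κ.1) : x ∈ τ₂.1 := by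
  obtain ⟨a, ha, b, hb, hab⟩ := mem_cspan_iff _ _ hxy
  have hb1 : b ∈ τ₁.1 := h1 hb
  have hs : x + b = y + a := by
    have : x = (a - b) + y := by rw [← hab]; abel
    rw [this]; abel
  have hm : x + b ∈ τ₁.1 ⊓ τ₂.1 :=
    ⟨τ₁.1.add_mem hx hb1, by rw [hs]; exact τ₂.1.add_mem hy (h2 ha)⟩
  obtain ⟨⟨u, hu, hF⟩, -⟩ := F.inter_face _ τ₁.2 _ τ₂.2
  have h0 := ((hF _).1 hm).2
  rw [inner_add_right] at h0
  have e1 := hu x hx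
  have e2 := hu b hb1
  exact ((hF x).2 ⟨hx, by linarith⟩).2

namespace AdmissiblePartition

variable {n : ℕ} {F : Fan n} (P : AdmissiblePartition F)

theorem cspan_eq {σ₁ σ₂ : F.Cone} (h : P.rel σ₁ σ₂) : cspan σ₁.1 = cspan σ₂.1 :=
  cspan_eq_of_perp (P.perp_eq _ _ h)

theorem exists_lift {κ₁ κ₂ τ₂ : F.Cone} (h : P.rel κ₁ κ₂) (hτ : κ₂ ≤ τ₂) :
    ∃ τ₁ : F.Cone, κ₁ ≤ τ₁ ∧ proj κ₁.1 τ₁.1 = proj κ₂.1 τ₂.1 := by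
  have : proj κ₂.1 τ₂.1 ∈ F.projStar κ₁.1 := by
    rw [P.projStar_eq _ _ h]
    exact ⟨τ₂.1, ⟨τ₂.2, hτ⟩, rfl⟩
  obtain ⟨τ, ⟨hm, hle⟩, he⟩ := this
  exact ⟨⟨τ, hm⟩, hle, he⟩

theorem proj_comp {σ₁ σ₂ κ₁ κ₂ τ₁ τ₂ : F.Cone} (hσ : P.rel σ₁ σ₂) (hκ : P.rel κ₁ κ₂)
    (h1 : σ₁ ≤ κ₁) (h2 : σ₂ ≤ κ₂) (k1 : κ₁ ≤ τ₁) (k2 : κ₂ ≤ τ₂)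
    (e : proj σ₁.1 κ₁.1 = proj σ₂.1 κ₂.1) (e2 : proj κ₁.1 τ₁.1 = proj κ₂.1 τ₂.1) :
    proj σ₁.1 τ₁.1 = proj σ₂.1 τ₂.1 := by
  obtain ⟨τ, hτ, hp⟩ := P.exists_lift (P.rel.symm hσ) (h1.trans k1)
  rw [← hp]
  have hs := P.cspan_eq hσ
  have hk := P.cspan_eq hκ
  have hp' := (proj_eq_iff hs _ _).1 hp.symm
  have e' := (proj_eq_iff hs _ _).1 e
  have e2' := (proj_eq_iff hk _ _).1 e2
  have hκτ : κ₂ ≤ τ := by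
    intro k hk'
    obtain ⟨a, ha, hak⟩ := e'.2 k hk'
    obtain ⟨t, ht, hat⟩ := hp'.1 a (k1 ha)
    refine F.mem_of_sub_mem h2 hτ hk' ht ?_
    have : k - t = (a - t) - (a - k) := by abel
    rw [this]
    exact Submodule.sub_mem _ hat hak
  have hUV : cspan σ₂.1 ≤ cspan κ₂.1 := cspan_mono h2
  suffices h : τ = τ₂ by rw [h]
  apply le_antisymm
  · intro t ht
    obtain ⟨a, ha, hat⟩ := hp'.2 t ht
    obtain ⟨s, hs', has⟩ := e2'.1 a ha
    refine F.mem_of_sub_mem hκτ k2 ht hs' ?_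
    have : t - s = (a - s) - (a - t) := by abel
    rw [this]
    exact Submodule.sub_mem _ has (hUV hat)
  · intro t ht
    obtain ⟨a, ha, hat⟩ := e2'.2 t ht
    obtain ⟨s, hs', has⟩ := hp'.1 a ha
    refine F.mem_of_sub_mem k2 hκτ ht hs' ?_
    have : t - s = (a - s) - (a - t) := by abel
    rw [this]
    exact Submodule.sub_mem _ (hUV has) hat

/-- Objects of the category of the partitioned fan: the blocks `[σ]` of the partition. -/
def Obj (P : AdmissiblePartition F) : Type := Quotient P.rel

/-- The block of a cone. -/
def block (σ : F.Cone) : P.Obj := Quotient.mk P.rel σ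

theorem block_eq_iff {σ τ : F.Cone} : P.block σ = P.block τ ↔ P.rel σ τ := Quotient.eq

/-- The inclusions `f_{σ τ}` with `σ ∈ a` and `τ ∈ b`. -/
structure PreHom (a b : P.Obj) where
  src : F.Cone
  tgt : F.Cone
  le : src ≤ tgt
  src_mem : P.block src = a
  tgt_mem : P.block tgt = b

/-- `f_{σ₁ τ₁} ∼ f_{σ₂ τ₂}` if and only if `π_{σ₁}(τ₁) = π_{σ₂}(τ₂)`. -/
instance homSetoid (a b : P.Obj) : Setoid (P.PreHom a b) where
  r f g := proj f.src.1 f.tgt.1 = proj g.src.1 g.tgt.1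
  iseqv := ⟨fun _ => rfl, fun h => h.symm, fun h h' => h.trans h'⟩

variable {P}

theorem PreHom.src_rel {a b b' : P.Obj} (f : P.PreHom a b) (g : P.PreHom a b') :
    P.rel f.src g.src := P.block_eq_iff.1 (f.src_mem.trans g.src_mem.symm)

theorem PreHom.tgt_rel {a a' b : P.Obj} (f : P.PreHom a b) (g : P.PreHom a' b) :
    P.rel f.tgt g.tgt := P.block_eq_iff.1 (f.tgt_mem.trans g.tgt_mem.symm)

theorem PreHom.mid_rel {a b c : P.Obj} (f : P.PreHom a b) (g : P.PreHom b c) :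
    P.rel f.tgt g.src := P.block_eq_iff.1 (f.tgt_mem.trans g.src_mem.symm)

/-- The target of a representative of `g` whose source is the target of `f`. -/
def PreHom.lift {a b c : P.Obj} (f : P.PreHom a b) (g : P.PreHom b c) : F.Cone :=
  (P.exists_lift (f.mid_rel g) g.le).choose

theorem PreHom.le_lift {a b c : P.Obj} (f : P.PreHom a b) (g : P.PreHom b c) :
    f.tgt ≤ f.lift g := (P.exists_lift (f.mid_rel g) g.le).choose_spec.1

theorem PreHom.proj_lift {a b c : P.Obj} (f : P.PreHom a b) (g : P.PreHom b c) :
    proj f.tgt.1 (f.lift g).1 = proj g.src.1 g.tgt.1 :=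
  (P.exists_lift (f.mid_rel g) g.le).choose_spec.2

/-- Composition on representatives: replace `f_{κ₂ τ₂}` by an equivalent `f_{κ₁ τ₁}` that is
composable with `f_{σ κ₁}`, and take `f_{σ τ₁}`. -/
def PreHom.comp {a b c : P.Obj} (f : P.PreHom a b) (g : P.PreHom b c) : P.PreHom a c where
  src := f.src
  tgt := f.lift g
  le := f.le.trans (f.le_lift g)
  src_mem := f.src_mem
  tgt_mem := (P.block_eq_iff.2 (P.admissible _ _ _ _ (f.mid_rel g) (f.le_lift g) g.le
    (f.proj_lift g))).trans g.tgt_mem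

theorem PreHom.comp_equiv {a b c : P.Obj} (f f' : P.PreHom a b) (g g' : P.PreHom b c)
    (hf : f ≈ f') (hg : g ≈ g') : f.comp g ≈ f'.comp g' :=
  P.proj_comp (f.src_rel f') (f.tgt_rel f') f.le f'.le (f.le_lift g) (f'.le_lift g') hf
    ((f.proj_lift g).trans (Eq.trans hg (f'.proj_lift g').symm))

theorem PreHom.comp_equiv_of_eq {a b c : P.Obj} (f : P.PreHom a b) (g : P.PreHom b c)
    (h : P.PreHom a c) (h1 : h.src = f.src) (h2 : f.tgt = g.src) (h3 : h.tgt = g.tgt) :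
    f.comp g ≈ h := by
  have := P.proj_comp (σ₁ := f.src) (σ₂ := f.src) (τ₁ := f.lift g) (τ₂ := g.tgt)
    (P.rel.refl _) (P.rel.refl _) f.le f.le (f.le_lift g) (h2 ▸ g.le) rfl
    ((f.proj_lift g).trans (by rw [h2]))
  change proj f.src.1 (f.lift g).1 = proj h.src.1 h.tgt.1
  rw [this, h1, h3]

theorem PreHom.equiv_id {a : P.Obj} {σ τ : F.Cone} (h : P.rel σ τ) (hσ : P.block σ = a)
    (hτ : P.block τ = a) :
    (⟨σ, σ, le_rfl, hσ, hσ⟩ : P.PreHom a a) ≈ ⟨τ, τ, le_rfl, hτ, hτ⟩ :=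
  (proj_eq_iff (P.cspan_eq h) _ _).2
    ⟨fun x hx => ⟨0, Submodule.zero_mem _, by
        rw [sub_zero, ← P.cspan_eq h]; exact subset_cspan hx⟩,
     fun y hy => ⟨0, Submodule.zero_mem _, by
        rw [zero_sub]; exact Submodule.neg_mem _ (subset_cspan hy)⟩⟩

theorem PreHom.id_comp_equiv {a b : P.Obj} (f : P.PreHom a b) (σ : F.Cone) (hσ : P.block σ = a) :
    PreHom.comp ⟨σ, σ, le_rfl, hσ, hσ⟩ f ≈ f :=
  PreHom.proj_lift ⟨σ, σ, le_rfl, hσ, hσ⟩ f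

theorem PreHom.comp_id_equiv {a b : P.Obj} (f : P.PreHom a b) (σ : F.Cone) (hσ : P.block σ = b) :
    PreHom.comp f ⟨σ, σ, le_rfl, hσ, hσ⟩ ≈ f := by
  have hr : P.rel σ f.tgt := P.block_eq_iff.1 (hσ.trans f.tgt_mem.symm)
  exact Setoid.trans (PreHom.comp_equiv f f _ _ (Setoid.refl _)
    (PreHom.equiv_id hr hσ f.tgt_mem))
    (PreHom.comp_equiv_of_eq _ _ _ rfl rfl rfl)

theorem PreHom.assoc_equiv {a b c d : P.Obj} (f : P.PreHom a b) (g : P.PreHom b c)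
    (h : P.PreHom c d) : (f.comp g).comp h ≈ f.comp (g.comp h) := by
  obtain ⟨g', hg1, hg2, hg⟩ : ∃ g' : P.PreHom b c, g'.src = f.tgt ∧ g'.tgt = (f.comp g).tgt ∧
      g' ≈ g := ⟨⟨f.tgt, f.lift g, f.le_lift g, f.tgt_mem, (f.comp g).tgt_mem⟩, rfl, rfl,
        f.proj_lift g⟩
  obtain ⟨h', hh1, hh2, hh⟩ : ∃ h' : P.PreHom c d, h'.src = (f.comp g).tgt ∧
      h'.tgt = ((f.comp g).comp h).tgt ∧ h' ≈ h :=
    ⟨⟨(f.comp g).tgt, (f.comp g).lift h, (f.comp g).le_lift h,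
      (f.comp g).tgt_mem, ((f.comp g).comp h).tgt_mem⟩, rfl, rfl, (f.comp g).proj_lift h⟩
  obtain ⟨k, hk1, hk2⟩ : ∃ k : P.PreHom b d, k.src = f.tgt ∧ k.tgt = ((f.comp g).comp h).tgt :=
    ⟨⟨f.tgt, (f.comp g).lift h, (f.le_lift g).trans ((f.comp g).le_lift h),
      f.tgt_mem, ((f.comp g).comp h).tgt_mem⟩, rfl, rfl⟩
  have e1 : f.comp (g.comp h) ≈ f.comp (g'.comp h') :=
    PreHom.comp_equiv _ _ _ _ (Setoid.refl _)
      (PreHom.comp_equiv _ _ _ _ (Setoid.symm hg) (Setoid.symm hh))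
  have e2 : g'.comp h' ≈ k :=
    PreHom.comp_equiv_of_eq g' h' k (hk1.trans hg1.symm) (hg2.trans hh1.symm) (hk2.trans hh2.symm)
  have e3 : f.comp (g'.comp h') ≈ f.comp k := PreHom.comp_equiv _ _ _ _ (Setoid.refl _) e2
  have e4 : f.comp k ≈ (f.comp g).comp h :=
    PreHom.comp_equiv_of_eq f k ((f.comp g).comp h) rfl hk1.symm hk2.symm
  exact Setoid.symm (Setoid.trans e1 (Setoid.trans e3 e4))

variable (P)

/-- The category `ℭ(Σ, 𝔓)` of the partitioned fan. -/
instance category : Category P.Obj where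
  Hom a b := Quotient (P.homSetoid a b)
  id a := Quotient.mk _ ⟨a.out, a.out, le_rfl, Quotient.out_eq a, Quotient.out_eq a⟩
  comp f g := Quotient.map₂ PreHom.comp (fun _ _ hf _ _ hg => PreHom.comp_equiv _ _ _ _ hf hg) f g
  id_comp f := Quotient.inductionOn f fun f => Quotient.sound (PreHom.id_comp_equiv f _ _)
  comp_id f := Quotient.inductionOn f fun f => Quotient.sound (PreHom.comp_id_equiv f _ _)
  assoc f g h := Quotient.inductionOn₃ f g h fun f g h =>
    Quotient.sound (PreHom.assoc_equiv f g h)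

/-- The morphism `[f_{σ τ}] : [σ] ⟶ [τ]`. -/
def homMk {σ τ : F.Cone} (h : σ ≤ τ) : P.block σ ⟶ P.block τ :=
  Quotient.mk (P.homSetoid _ _) ⟨σ, τ, h, rfl, rfl⟩

theorem homMk_comp {σ κ τ : F.Cone} (h : σ ≤ κ) (h' : κ ≤ τ) :
    P.homMk h ≫ P.homMk h' = P.homMk (h.trans h') :=
  Quotient.sound (PreHom.comp_equiv_of_eq _ _ _ rfl rfl rfl)

theorem homMk_self (σ : F.Cone) : P.homMk (le_refl σ) = 𝟙 (P.block σ) :=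
  Quotient.sound (PreHom.equiv_id
    (P.block_eq_iff.1 (Quotient.out_eq (P.block σ)).symm) rfl _)

end AdmissiblePartition

/-! ### Fan posets and the picture group -/

/-- The maximal cones of a complete fan in `ℝⁿ`, i.e. its cones of dimension `n`. -/
def Fan.Chamber {n : ℕ} (F : Fan n) := {σ : F.Cone // cdim σ.1 = n}

/-- A chamber viewed as a cone of the fan. -/
def Fan.Chamber.cone {n : ℕ} {F : Fan n} (τ : F.Chamber) : F.Cone := τ.1

/-- The cones of codimension one (the walls). -/
def Fan.Wall {n : ℕ} (F : Fan n) := {σ : F.Cone // cdim σ.1 + 1 = n}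

/-- A fan poset: a partial order on the maximal cones of a finite complete fan such that the union
of every interval is a convex polyhedral cone (not necessarily strongly convex), such that the
maximal cones containing a given cone `σ` form an interval `[σ⁻, σ⁺]`, and such that every arrow of
the Hasse diagram joins two maximal cones that are separated by a cone of codimension one. -/
structure FanPoset {n : ℕ} (F : Fan n) where
  finite : F.cones.Finite
  complete : ∀ x : E n, ∃ σ ∈ F.cones, x ∈ σ
  order : PartialOrder F.Chamber
  interval_polyhedral : ∀ a b : F.Chamber, order.le a b → ∃ S : Set (E n), S.Finite ∧
    {x | ∃ τ : F.Chamber, order.le a τ ∧ order.le τ b ∧ x ∈ τ.cone.1} =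
      (PointedCone.hull ℝ S : Set (E n))
  facial : ∀ σ : F.Cone, ∃ lo hi : F.Chamber, order.le lo hi ∧
    ∀ τ : F.Chamber, σ ≤ τ.cone ↔ order.le lo τ ∧ order.le τ hi
  covers_dim : ∀ a b : F.Chamber, a ⋖ b → cdim (a.cone.1 ⊓ b.cone.1) + 1 = n

namespace FanPoset

variable {n : ℕ} {F : Fan n} (Q : FanPoset F)

/-- The order relation of the fan poset. -/
def le (a b : F.Chamber) : Prop := Q.order.le a b

/-- There is an arrow `a → b` in the Hasse diagram: `b` is covered by `a`. -/
def Arrow (a b : F.Chamber) : Prop :=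
  letI := Q.order
  b ⋖ a

/-- The codimension one cone labelling an arrow of the Hasse diagram. -/
def label {a b : F.Chamber} (h : Q.Arrow a b) : F.Wall :=
  ⟨⟨b.cone.1 ⊓ a.cone.1,
    F.face_mem _ b.cone.2 _ (F.inter_face _ b.cone.2 _ a.cone.2).1⟩, Q.covers_dim b a h⟩

/-- `σ⁻`, the least element of the facial interval of `σ`. -/
def lower (σ : F.Cone) : F.Chamber := (Q.facial σ).choose

theorem lower_le_iff (σ : F.Cone) : ∃ hi, Q.le (Q.lower σ) hi ∧
    ∀ τ : F.Chamber, σ ≤ τ.cone ↔ Q.le (Q.lower σ) τ ∧ Q.le τ hi :=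
  (Q.facial σ).choose_spec

theorem lower_mono {σ κ : F.Cone} (h : σ ≤ κ) : Q.le (Q.lower σ) (Q.lower κ) := by
  obtain ⟨hi, hh, H⟩ := Q.lower_le_iff σ
  obtain ⟨hi', hh', H'⟩ := Q.lower_le_iff κ
  exact ((H _).1 (h.trans ((H' _).2 ⟨Q.order.le_refl _, hh'⟩))).1

/-- `Q.Chain a b w`: the list `w` consists of the walls labelling, in order, the arrows of a
maximal chain `a → ⋯ → b` of the interval between `b` and `a`, read from `a` down to `b`. -/
inductive Chain : F.Chamber → F.Chamber → List F.Wall → Prop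
  | nil (a : F.Chamber) : Chain a a []
  | cons {a b c : F.Chamber} {w : List F.Wall} (h : Q.Arrow a b) :
      Chain b c w → Chain a c (Q.label h :: w)

theorem Chain.append {Q : FanPoset F} {a b c : F.Chamber} {v w : List F.Wall}
    (h : Q.Chain a b v) (h' : Q.Chain b c w) : Q.Chain a c (v ++ w) := by
  induction h with
  | nil => exact h'
  | cons h _ ih => exact Chain.cons h (ih h')

theorem finite_chamber (Q : FanPoset F) : Finite F.Chamber :=
  have _ : Finite F.Cone := Q.finite
  Subtype.finite

theorem exists_chain {a b : F.Chamber} (h : Q.le b a) : ∃ w, Q.Chain a b w := by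
  let _ := Q.order
  have _ := Q.finite_chamber
  induction a using WellFoundedLT.induction with | _ a ih =>
  rcases eq_or_ne b a with rfl | hne
  · exact ⟨[], Chain.nil _⟩
  · obtain ⟨c, hbc, hc⟩ := exists_le_covBy_of_lt (lt_of_le_of_ne h hne)
    obtain ⟨w, hw⟩ := ih c hc.lt hbc
    exact ⟨_, Chain.cons (Q := Q) (a := a) (b := c) hc hw⟩

end FanPoset

section PictureGroup

variable {n : ℕ} {F : Fan n} (P : AdmissiblePartition F) (Q : FanPoset F)

/-- The generators of the picture group: the blocks `[σ]` of the cones of codimension one. -/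
def Gen (P : AdmissiblePartition F) : Type := {b : P.Obj // ∃ σ : F.Wall, P.block σ.1 = b}

/-- The product `X_{[σ₁]} ⋯ X_{[σ_k]}` in the free group on the generators. -/
def word (w : List F.Wall) : FreeGroup (Gen P) :=
  (w.map fun σ => FreeGroup.of (⟨P.block σ.1, σ, rfl⟩ : Gen P)).prod

/-- The two families of relations of the picture group. -/
inductive PictureRel : FreeGroup (Gen P) → FreeGroup (Gen P) → Prop
  | chains {a b : F.Chamber} {v w : List F.Wall} (hv : Q.Chain a b v) (hw : Q.Chain a b w) :
      PictureRel (word P v) (word P w)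
  | homs {σ₁ κ₁ σ₂ κ₂ : F.Cone} (h₁ : σ₁ ≤ κ₁) (h₂ : σ₂ ≤ κ₂) (hσ : P.rel σ₁ σ₂)
      (hκ : P.rel κ₁ κ₂) (hf : proj σ₁.1 κ₁.1 = proj σ₂.1 κ₂.1) {v w : List F.Wall}
      (hv : Q.Chain (Q.lower κ₁) (Q.lower σ₁) v) (hw : Q.Chain (Q.lower κ₂) (Q.lower σ₂) w) :
      PictureRel (word P v) (word P w)

/-- The picture group `G(Σ, 𝔓, 𝒫)`. -/
abbrev PictureGroup : Type := PresentedGroup {r | ∃ x y, PictureRel P Q x y ∧ r = x * y⁻¹}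

/-- The image of a word in the picture group. -/
def wordElt (w : List F.Wall) : PictureGroup P Q := PresentedGroup.mk _ (word P w)

theorem wordElt_eq {v w : List F.Wall} (h : PictureRel P Q (word P v) (word P w)) :
    wordElt P Q v = wordElt P Q w := by
  have h1 : PresentedGroup.mk {r | ∃ x y, PictureRel P Q x y ∧ r = x * y⁻¹}
      (word P v * (word P w)⁻¹) = 1 :=
    (PresentedGroup.one_of_mem ⟨_, _, h, rfl⟩)
  rw [map_mul, map_inv, mul_inv_eq_one] at h1
  exact h1

/-- The element `X_{[b, a]}` of the picture group attached to `b ≤ a`. -/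
def pathElt {a b : F.Chamber} (h : Q.le b a) : PictureGroup P Q :=
  wordElt P Q (Q.exists_chain h).choose

theorem pathElt_eq {a b : F.Chamber} (h : Q.le b a) {w : List F.Wall} (hw : Q.Chain a b w) :
    pathElt P Q h = wordElt P Q w :=
  wordElt_eq P Q (PictureRel.chains (Q.exists_chain h).choose_spec hw)

theorem pathElt_mul {a b c : F.Chamber} (h : Q.le b a) (h' : Q.le c b) (h'' : Q.le c a) :
    pathElt P Q h * pathElt P Q h' = pathElt P Q h'' := by
  obtain ⟨v, hv⟩ := Q.exists_chain h
  obtain ⟨w, hw⟩ := Q.exists_chain h'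
  rw [pathElt_eq P Q h hv, pathElt_eq P Q h' hw, pathElt_eq P Q h'' (hv.append hw)]
  simp only [wordElt, word, List.map_append, List.prod_append]
  exact (map_mul (PresentedGroup.mk _) _ _).symm

/-- `X_{[σ⁻, κ⁻]}` for an inclusion `f_{σ κ}`. -/
def preHomElt {a b : P.Obj} (f : P.PreHom a b) : PictureGroup P Q :=
  pathElt P Q (Q.lower_mono f.le)

theorem preHomElt_eq {a b : P.Obj} (f g : P.PreHom a b) (h : f ≈ g) :
    preHomElt P Q f = preHomElt P Q g :=
  wordElt_eq P Q (PictureRel.homs f.le g.le (f.src_rel g) (f.tgt_rel g) h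
    (Q.exists_chain (Q.lower_mono f.le)).choose_spec (Q.exists_chain (Q.lower_mono g.le)).choose_spec)

/-- `X_{[σ⁻, κ⁻]}` for a morphism `[f_{σ κ}]`. -/
def homElt {a b : P.Obj} (f : a ⟶ b) : PictureGroup P Q :=
  Quotient.lift (s := P.homSetoid a b) (preHomElt P Q) (preHomElt_eq P Q) f

theorem preHomElt_comp {a b c : P.Obj} (f : P.PreHom a b) (g : P.PreHom b c) :
    preHomElt P Q (f.comp g) = preHomElt P Q g * preHomElt P Q f := by
  have e := preHomElt_eq P Q (a := b) (b := c)
    ⟨f.tgt, f.lift g, f.le_lift g, f.tgt_mem, (f.comp g).tgt_mem⟩ g (f.proj_lift g)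
  rw [← e]
  exact (pathElt_mul P Q _ _ _).symm

/-- The functor `Ψ : ℭ(Σ, 𝔓) ⥤ G(Σ, 𝔓, 𝒫)`, `[f_{σ κ}] ↦ X_{[σ⁻, κ⁻]}`, to the picture group
viewed as a groupoid with one object. -/
def pictureFunctor : P.Obj ⥤ SingleObj (PictureGroup P Q) where
  obj _ := SingleObj.star _
  map f := homElt P Q f
  map_id a := by
    exact pathElt_eq P Q (Q.lower_mono (le_refl (Quotient.out a))) (FanPoset.Chain.nil _)
  map_comp f g := Quotient.inductionOn₂ f g fun f g => preHomElt_comp P Q f g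

/-- The defining formula of the functor. -/
theorem pictureFunctor_map {σ κ : F.Cone} (h : σ ≤ κ) :
    (pictureFunctor P Q).map (P.homMk h) = pathElt P Q (Q.lower_mono h) := rfl

end PictureGroup

/-! ### Hyperplane arrangements -/

/-- A central hyperplane arrangement in `ℝⁿ`: finitely many distinct hyperplanes, each given by a
nonzero normal vector. -/
structure Arrangement (n : ℕ) (ι : Type) where
  normal : ι → E n
  normal_ne_zero : ∀ i, normal i ≠ 0
  hyperplane_injective : Function.Injective fun i => (Submodule.span ℝ {normal i})ᗮ

namespace Arrangement

variable {n : ℕ} {ι : Type} (A : Arrangement n ι)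

/-- The `i`-th hyperplane. -/
def hyperplane (i : ι) : Submodule ℝ (E n) := (Submodule.span ℝ {A.normal i})ᗮ

theorem mem_hyperplane {i : ι} {x : E n} : x ∈ A.hyperplane i ↔ inner ℝ (A.normal i) x = 0 :=
  Submodule.mem_orthogonal_singleton_iff_inner_right

/-- The cone of the arrangement having `x` in its relative interior: all points that lie on every
hyperplane through `x`, and on the same closed side as `x` of every other hyperplane. -/
def face (x : E n) : PointedCone ℝ (E n) where
  carrier := {y | ∀ i, (inner ℝ (A.normal i) x = 0 → inner ℝ (A.normal i) y = 0) ∧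
    (0 < inner ℝ (A.normal i) x → 0 ≤ inner ℝ (A.normal i) y) ∧
    (inner ℝ (A.normal i) x < 0 → inner ℝ (A.normal i) y ≤ 0)}
  add_mem' := by
    intro a b ha hb i
    obtain ⟨a1, a2, a3⟩ := ha i
    obtain ⟨b1, b2, b3⟩ := hb i
    rw [inner_add_right]
    exact ⟨fun h => by rw [a1 h, b1 h, add_zero], fun h => add_nonneg (a2 h) (b2 h),
      fun h => add_nonpos (a3 h) (b3 h)⟩
  zero_mem' := by intro i; simp
  smul_mem' := by
    intro c a ha i
    obtain ⟨a1, a2, a3⟩ := ha i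
    have e : inner ℝ (A.normal i) (c • a) = (c : ℝ) * inner ℝ (A.normal i) a :=
      real_inner_smul_right _ _ _
    rw [e]
    exact ⟨fun h => by rw [a1 h, mul_zero], fun h => mul_nonneg c.2 (a2 h),
      fun h => mul_nonpos_of_nonneg_of_nonpos c.2 (a3 h)⟩

theorem mem_face {x y : E n} : y ∈ A.face x ↔
    ∀ i, (inner ℝ (A.normal i) x = 0 → inner ℝ (A.normal i) y = 0) ∧
    (0 < inner ℝ (A.normal i) x → 0 ≤ inner ℝ (A.normal i) y) ∧
    (inner ℝ (A.normal i) x < 0 → inner ℝ (A.normal i) y ≤ 0) := Iff.rfl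

theorem self_mem_face (x : E n) : x ∈ A.face x :=
  fun _ => ⟨id, le_of_lt, le_of_lt⟩

theorem face_le {x y : E n} (h : y ∈ A.face x) : A.face y ≤ A.face x := by
  intro z hz i
  obtain ⟨a1, a2, a3⟩ := h i
  obtain ⟨b1, b2, b3⟩ := hz i
  refine ⟨fun e => b1 (a1 e), fun e => ?_, fun e => ?_⟩
  · rcases (a2 e).eq_or_lt with h0 | h0
    · exact (b1 h0.symm).ge
    · exact b2 h0
  · rcases (a3 e).eq_or_lt with h0 | h0
    · exact (b1 h0).le
    · exact b3 h0

theorem face_eq_of_sign {x y : E n}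
    (h : ∀ i, SignType.sign (inner ℝ (A.normal i) x) = SignType.sign (inner ℝ (A.normal i) y)) :
    A.face x = A.face y := by
  have key : ∀ {u v : E n}, (∀ i, SignType.sign (inner ℝ (A.normal i) u) =
      SignType.sign (inner ℝ (A.normal i) v)) → A.face u ≤ A.face v := by
    intro u v h
    apply A.face_le
    intro i
    have := h i
    refine ⟨fun e => ?_, fun e => ?_, fun e => ?_⟩
    · rw [e, sign_zero, sign_eq_zero_iff] at this; exact this
    · rw [sign_pos e, sign_eq_one_iff] at this; exact this.le
    · rw [sign_neg e, sign_eq_neg_one_iff] at this; exact this.le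
  exact le_antisymm (key h) (key fun i => (h i).symm)

/-- The cones of the arrangement. -/
def faces : Set (PointedCone ℝ (E n)) := Set.range A.face

/-- An arrangement is simplicial if all its cones are simplicial. -/
def IsSimplicial : Prop := ∀ σ ∈ A.faces, σ.IsSimplicial

/-- A flat: an intersection of hyperplanes of the arrangement. -/
def IsFlat (X : Submodule ℝ (E n)) : Prop := ∃ I : Set ι, X = ⨅ i ∈ I, A.hyperplane i

/-- The support of a cone: the smallest flat that contains it. -/
def support (σ : PointedCone ℝ (E n)) : Submodule ℝ (E n) :=
  sInf {X | A.IsFlat X ∧ (σ : Set (E n)) ⊆ X}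

theorem finite_faces [Finite ι] : A.faces.Finite := by
  classical
  let s : E n → ι → SignType := fun x i => SignType.sign (inner ℝ (A.normal i) x)
  let g : (ι → SignType) → PointedCone ℝ (E n) := fun t =>
    if h : ∃ x, s x = t then A.face h.choose else ⊥
  refine (Set.finite_range g).subset ?_
  rintro _ ⟨x, rfl⟩
  have hx : ∃ y, s y = s x := ⟨x, rfl⟩
  refine ⟨s x, ?_⟩
  simp only [g, dif_pos hx]
  exact A.face_eq_of_sign fun i => congrFun hx.choose_spec i

theorem exists_eps [Finite ι] (x z : E n) : ∃ ε : ℝ, 0 < ε ∧ ∀ i,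
    (0 < inner ℝ (A.normal i) x → 0 < inner ℝ (A.normal i) (x + ε • z)) ∧
    (inner ℝ (A.normal i) x < 0 → inner ℝ (A.normal i) (x + ε • z) < 0) := by
  have hc : ∀ i, Filter.Tendsto (fun ε : ℝ => (inner ℝ (A.normal i) (x + ε • z) : ℝ))
      (nhdsWithin 0 (Set.Ioi 0)) (nhds (inner ℝ (A.normal i) x)) := by
    intro i
    have : Continuous fun ε : ℝ => (inner ℝ (A.normal i) (x + ε • z) : ℝ) := by fun_prop
    have h := (this.tendsto 0).mono_left (nhdsWithin_le_nhds (s := Set.Ioi (0 : ℝ)))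
    simpa using h
  have hev : ∀ᶠ ε in nhdsWithin (0 : ℝ) (Set.Ioi 0), ∀ i,
      (0 < inner ℝ (A.normal i) x → 0 < inner ℝ (A.normal i) (x + ε • z)) ∧
      (inner ℝ (A.normal i) x < 0 → inner ℝ (A.normal i) (x + ε • z) < 0) := by
    rw [Filter.eventually_all]
    intro i
    refine Filter.Eventually.and ?_ ?_
    · by_cases h : 0 < inner ℝ (A.normal i) x
      · filter_upwards [(hc i).eventually (lt_mem_nhds h)] with ε he _ using he
      · exact Filter.Eventually.of_forall fun _ h' => absurd h' h
    · by_cases h : inner ℝ (A.normal i) x < 0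
      · filter_upwards [(hc i).eventually (gt_mem_nhds h)] with ε he _ using he
      · exact Filter.Eventually.of_forall fun _ h' => absurd h' h
  obtain ⟨ε, h1, h2⟩ := (hev.and self_mem_nhdsWithin).exists
  exact ⟨ε, h2, h1⟩

theorem mem_cspan_face [Finite ι] {x z : E n} :
    z ∈ cspan (A.face x) ↔ ∀ i, inner ℝ (A.normal i) x = 0 → inner ℝ (A.normal i) z = 0 := by
  constructor
  · intro hz i hi
    obtain ⟨a, ha, b, hb, rfl⟩ := mem_cspan_iff _ _ hz
    rw [inner_sub_right, (ha i).1 hi, (hb i).1 hi, sub_zero]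
  · intro h
    obtain ⟨ε, hε, H⟩ := A.exists_eps x z
    have hm : x + ε • z ∈ A.face x := by
      intro i
      refine ⟨fun e => ?_, fun e => ((H i).1 e).le, fun e => ((H i).2 e).le⟩
      rw [inner_add_right, real_inner_smul_right, e, h i e, mul_zero, add_zero]
    have e : z = ε⁻¹ • ((x + ε • z) - x) := by
      rw [add_sub_cancel_left, smul_smul, inv_mul_cancel₀ hε.ne', one_smul]
    rw [e]
    exact Submodule.smul_mem _ _ (Submodule.sub_mem _ (subset_cspan hm)
      (subset_cspan (A.self_mem_face x)))

theorem support_face [Finite ι] (x : E n) : A.support (A.face x) = cspan (A.face x) := by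
  apply le_antisymm
  · refine sInf_le ⟨⟨{i | inner ℝ (A.normal i) x = 0}, ?_⟩, Submodule.subset_span⟩
    ext z
    simp only [A.mem_cspan_face, Submodule.mem_iInf, Set.mem_ofPred_eq, mem_hyperplane]
  · refine le_sInf ?_
    rintro X ⟨-, h⟩
    exact Submodule.span_le.2 h

theorem exists_face_of_isFace [Finite ι] {x : E n} {G : PointedCone ℝ (E n)}
    (h : IsFace G (A.face x)) : ∃ y, A.face y = G := by
  classical
  have := Fintype.ofFinite ι
  obtain ⟨u, hu, hG⟩ := h
  have hc : ∀ i, ∃ y ∈ G, (∃ z ∈ G, inner ℝ (A.normal i) z ≠ 0) → inner ℝ (A.normal i) y ≠ 0 := by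
    intro i
    by_cases h : ∃ z ∈ G, inner ℝ (A.normal i) z ≠ 0
    · obtain ⟨z, hz, hz'⟩ := h
      exact ⟨z, hz, fun _ => hz'⟩
    · exact ⟨0, G.zero_mem, fun h' => absurd h' h⟩
  choose y hyG hy using hc
  have hsum : ∑ j, y j ∈ G := Submodule.sum_mem _ fun j _ => hyG j
  have hGx : ∀ z ∈ G, z ∈ A.face x := fun z hz => ((hG z).1 hz).1
  -- a vanishing pairing with the sum forces all of `G` onto the hyperplane
  have hzero : ∀ i, inner ℝ (A.normal i) (∑ j, y j) = 0 → ∀ z ∈ G, inner ℝ (A.normal i) z = 0 := by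
    intro i hi z hz
    by_contra hne
    have h1 := hy i ⟨z, hz, hne⟩
    rw [inner_sum] at hi
    rcases lt_trichotomy (inner ℝ (A.normal i) x) 0 with hx | hx | hx
    · exact h1 ((Finset.sum_eq_zero_iff_of_nonpos
        (fun j _ => ((hGx _ (hyG j)) i).2.2 hx)).1 hi i (Finset.mem_univ _))
    · exact h1 (((hGx _ (hyG i)) i).1 hx)
    · exact h1 ((Finset.sum_eq_zero_iff_of_nonneg
        (fun j _ => ((hGx _ (hyG j)) i).2.1 hx)).1 hi i (Finset.mem_univ _))
  refine ⟨∑ j, y j, le_antisymm ?_ ?_⟩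
  · intro z hz
    have hzx : z ∈ A.face x := A.face_le (hGx _ hsum) hz
    refine (hG z).2 ⟨hzx, le_antisymm ?_ (hu z hzx)⟩
    obtain ⟨ε, hε, H⟩ := A.exists_eps (∑ j, y j) (-z)
    have hm : (∑ j, y j) + ε • (-z) ∈ A.face (∑ j, y j) := by
      intro i
      refine ⟨fun e => ?_, fun e => ((H i).1 e).le, fun e => ((H i).2 e).le⟩
      rw [inner_add_right, real_inner_smul_right, inner_neg_right, e, (hz i).1 e]; simp
    have h2 := hu _ (A.face_le (hGx _ hsum) hm)
    rw [inner_add_right, real_inner_smul_right, inner_neg_right, ((hG _).1 hsum).2] at h2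
    nlinarith
  · intro z hz i
    refine ⟨fun e => hzero i e z hz, fun e => ?_, fun e => ?_⟩
    · rcases lt_trichotomy (inner ℝ (A.normal i) x) 0 with hx | hx | hx
      · exact absurd e (not_lt.2 ((hGx _ hsum i).2.2 hx))
      · exact ((hGx z hz i).1 hx).ge
      · exact (hGx z hz i).2.1 hx
    · rcases lt_trichotomy (inner ℝ (A.normal i) x) 0 with hx | hx | hx
      · exact (hGx z hz i).2.2 hx
      · exact ((hGx z hz i).1 hx).le
      · exact absurd e (not_lt.2 ((hGx _ hsum i).2.1 hx))

theorem inf_isFace [Finite ι] (x y : E n) : IsFace (A.face x ⊓ A.face y) (A.face x) := by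
  classical
  have := Fintype.ofFinite ι
  let c : ι → ℝ := fun i =>
    if 0 < inner ℝ (A.normal i) x ∧ ¬ 0 < inner ℝ (A.normal i) y then 1
    else if inner ℝ (A.normal i) x < 0 ∧ ¬ inner ℝ (A.normal i) y < 0 then -1 else 0
  have hc : ∀ w ∈ A.face x, ∀ i, 0 ≤ c i * inner ℝ (A.normal i) w := by
    intro w hw i
    simp only [c]
    split_ifs with h1 h2
    · simpa using (hw i).2.1 h1.1
    · have := (hw i).2.2 h2.1
      linarith
    · simp
  have he : ∀ w, inner ℝ (∑ i, c i • A.normal i) w = ∑ i, c i * inner ℝ (A.normal i) w := by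
    intro w
    rw [sum_inner]
    simp only [real_inner_smul_left]
  refine ⟨∑ i, c i • A.normal i, fun w hw => ?_, fun v => ?_⟩
  · rw [he]
    exact Finset.sum_nonneg fun i _ => hc w hw i
  · rw [he]
    constructor
    · rintro ⟨hvx, hvy⟩
      refine ⟨hvx, Finset.sum_eq_zero fun i _ => ?_⟩
      simp only [c]
      split_ifs with h1 h2
      · have a := (hvx i).2.1 h1.1
        rcases (not_lt.1 h1.2).eq_or_lt with h | h
        · rw [(hvy i).1 h, mul_zero]
        · have b := (hvy i).2.2 h
          rw [le_antisymm b a, mul_zero]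
      · have a := (hvx i).2.2 h2.1
        rcases (not_lt.1 h2.2).eq_or_lt with h | h
        · rw [(hvy i).1 h.symm, mul_zero]
        · have b := (hvy i).2.1 h
          rw [le_antisymm a b, mul_zero]
      · rw [zero_mul]
    · rintro ⟨hvx, h0⟩
      refine ⟨hvx, fun i => ?_⟩
      have hi := (Finset.sum_eq_zero_iff_of_nonneg (fun j _ => hc v hvx j)).1 h0 i
        (Finset.mem_univ _)
      obtain ⟨a1, a2, a3⟩ := hvx i
      simp only [c] at hi
      split_ifs at hi with h1 h2
      · rw [one_mul] at hi
        simp [hi]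
      · have hi' : inner ℝ (A.normal i) v = 0 := by linarith
        simp [hi']
      · rcases lt_trichotomy (inner ℝ (A.normal i) x) 0 with hx | hx | hx
        · have hy : inner ℝ (A.normal i) y < 0 := by
            by_contra h; exact h2 ⟨hx, h⟩
          exact ⟨fun e => absurd e hy.ne, fun e => absurd e hy.not_gt, fun _ => a3 hx⟩
        · simp [a1 hx]
        · have hy : 0 < inner ℝ (A.normal i) y := by
            by_contra h; exact h1 ⟨hx, h⟩
          exact ⟨fun e => absurd e hy.ne', fun _ => a2 hx, fun e => absurd e hy.not_gt⟩

/-- The fan `Σ_ℋ` underlying a simplicial hyperplane arrangement `ℋ`. -/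
def fan [Finite ι] (hA : A.IsSimplicial) : Fan n where
  cones := A.faces
  simplicial := hA
  face_mem := by
    rintro _ ⟨x, rfl⟩ G hG
    exact A.exists_face_of_isFace hG
  inter_face := by
    rintro _ ⟨x, rfl⟩ _ ⟨y, rfl⟩
    exact ⟨A.inf_isFace x y, by rw [inf_comm]; exact A.inf_isFace y x⟩

/-! ### The flat-partition -/

theorem exists_near [Finite ι] {x t w : E n} (hx : x ∈ A.face t)
    (h : ∀ i, inner ℝ (A.normal i) x = 0 →
      (inner ℝ (A.normal i) t = 0 → inner ℝ (A.normal i) w = 0) ∧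
      (0 < inner ℝ (A.normal i) t → 0 ≤ inner ℝ (A.normal i) w) ∧
      (inner ℝ (A.normal i) t < 0 → inner ℝ (A.normal i) w ≤ 0)) :
    ∃ y ∈ A.face t, y - w ∈ cspan (A.face x) := by
  obtain ⟨ε, hε, H⟩ := A.exists_eps x w
  refine ⟨w + ε⁻¹ • x, fun i => ?_, ?_⟩
  · have e : inner ℝ (A.normal i) (w + ε⁻¹ • x) = ε⁻¹ * inner ℝ (A.normal i) (x + ε • w) := by
      simp only [inner_add_right, real_inner_smul_right]
      field_simp
      ring
    have hε' : 0 < ε⁻¹ := inv_pos.2 hε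
    rcases lt_trichotomy (inner ℝ (A.normal i) x) 0 with h0 | h0 | h0
    · have h1 := (H i).2 h0
      have h2 : inner ℝ (A.normal i) t < 0 := by
        by_contra hc
        rcases (not_lt.1 hc).eq_or_lt with h3 | h3
        · exact h0.ne ((hx i).1 h3.symm)
        · exact absurd h0 (not_lt.2 ((hx i).2.1 h3))
      rw [e]
      exact ⟨fun h => absurd h h2.ne, fun h => absurd h h2.not_gt,
        fun _ => (mul_neg_of_pos_of_neg hε' h1).le⟩
    · have e' : inner ℝ (A.normal i) (w + ε⁻¹ • x) = inner ℝ (A.normal i) w := by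
        rw [inner_add_right, real_inner_smul_right, h0, mul_zero, add_zero]
      rw [e']
      exact h i h0
    · have h1 := (H i).1 h0
      have h2 : 0 < inner ℝ (A.normal i) t := by
        by_contra hc
        rcases (not_lt.1 hc).eq_or_lt with h3 | h3
        · exact h0.ne' ((hx i).1 h3)
        · exact absurd h0 (not_lt.2 ((hx i).2.2 h3))
      rw [e]
      exact ⟨fun h => absurd h h2.ne', fun _ => (mul_pos hε' h1).le, fun h => absurd h h2.not_gt⟩
  · rw [add_sub_cancel_left]
    exact Submodule.smul_mem _ _ (subset_cspan (A.self_mem_face x))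

theorem zero_iff_of_cspan_eq [Finite ι] {x₁ x₂ : E n}
    (h : cspan (A.face x₁) = cspan (A.face x₂)) (i : ι) :
    inner ℝ (A.normal i) x₁ = 0 ↔ inner ℝ (A.normal i) x₂ = 0 := by
  constructor
  · exact fun e => A.mem_cspan_face.1 (h ▸ subset_cspan (A.self_mem_face x₂)) i e
  · exact fun e => A.mem_cspan_face.1 (h ▸ subset_cspan (A.self_mem_face x₁)) i e

theorem projStar_subset [Finite ι] (hA : A.IsSimplicial) {x₁ x₂ : E n}
    (h : cspan (A.face x₁) = cspan (A.face x₂)) :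
    (A.fan hA).projStar (A.face x₁) ⊆ (A.fan hA).projStar (A.face x₂) := by
  rintro _ ⟨_, ⟨⟨t, rfl⟩, ht⟩, rfl⟩
  have hxt : x₁ ∈ A.face t := ht (A.self_mem_face x₁)
  obtain ⟨ε, hε, H⟩ := A.exists_eps x₂ t
  have hz := A.zero_iff_of_cspan_eq h
  have hs : ∀ i, inner ℝ (A.normal i) x₂ = 0 →
      inner ℝ (A.normal i) (x₂ + ε • t) = ε * inner ℝ (A.normal i) t := by
    intro i e
    rw [inner_add_right, real_inner_smul_right, e, zero_add]
  have hxt2 : x₂ ∈ A.face (x₂ + ε • t) := by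
    intro i
    rcases lt_trichotomy (inner ℝ (A.normal i) x₂) 0 with h0 | h0 | h0
    · have h1 := (H i).2 h0
      exact ⟨fun h => absurd h h1.ne, fun h => absurd h h1.not_gt, fun _ => h0.le⟩
    · simp [h0]
    · have h1 := (H i).1 h0
      exact ⟨fun h => absurd h h1.ne', fun _ => h0.le, fun h => absurd h h1.not_gt⟩
  refine ⟨A.face (x₂ + ε • t), ⟨⟨_, rfl⟩, A.face_le hxt2⟩, ?_⟩
  refine ((proj_eq_iff h _ _).2 ⟨fun w hw => ?_, fun w hw => ?_⟩).symm
  · obtain ⟨y, hy, hyw⟩ := A.exists_near (w := w) hxt2 (fun i e => by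
      rw [hs i e]
      obtain ⟨a1, a2, a3⟩ := hw i
      exact ⟨fun h => a1 ((mul_eq_zero.1 h).resolve_left hε.ne'),
        fun h => a2 (pos_of_mul_pos_right h hε.le), fun h => a3 (neg_of_mul_neg_right h hε.le)⟩)
    refine ⟨y, hy, ?_⟩
    rw [← neg_sub]
    exact Submodule.neg_mem _ hyw
  · obtain ⟨y, hy, hyw⟩ := A.exists_near (w := w) hxt (fun i e => by
      have := hs i ((hz i).1 e)
      obtain ⟨a1, a2, a3⟩ := hw i
      rw [this] at a1 a2 a3
      exact ⟨fun h => a1 (by rw [h, mul_zero]), fun h => a2 (mul_pos hε h),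
        fun h => a3 (mul_neg_of_pos_of_neg hε h)⟩)
    exact ⟨y, hy, h ▸ hyw⟩

/-- The flat-partition: two cones are identified if and only if their supports are the same
flat. -/
def flatPartition [Finite ι] (hA : A.IsSimplicial) : AdmissiblePartition (A.fan hA) where
  rel := Setoid.comap (fun σ : (A.fan hA).Cone => A.support σ.1) ⟨Eq, eq_equivalence⟩
  perp_eq := by
    rintro ⟨_, x₁, rfl⟩ ⟨_, x₂, rfl⟩ h
    change A.support (A.face x₁) = A.support (A.face x₂) at h
    rw [A.support_face, A.support_face] at h
    exact congrArg _ h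
  projStar_eq := by
    rintro ⟨_, x₁, rfl⟩ ⟨_, x₂, rfl⟩ h
    change A.support (A.face x₁) = A.support (A.face x₂) at h
    rw [A.support_face, A.support_face] at h
    exact Set.Subset.antisymm (A.projStar_subset hA h) (A.projStar_subset hA h.symm)
  admissible := by
    rintro ⟨_, x₁, rfl⟩ ⟨_, x₂, rfl⟩ ⟨_, t₁, rfl⟩ ⟨_, t₂, rfl⟩ h h1 h2 hp
    change A.support (A.face x₁) = A.support (A.face x₂) at h
    change A.support (A.face t₁) = A.support (A.face t₂)
    change A.face x₁ ≤ A.face t₁ at h1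
    change A.face x₂ ≤ A.face t₂ at h2
    rw [A.support_face, A.support_face] at h ⊢
    obtain ⟨e1, e2⟩ := (proj_eq_iff h _ _).1 hp
    apply le_antisymm
    · refine Submodule.span_le.2 fun x hx => ?_
      obtain ⟨y, hy, hxy⟩ := e1 x hx
      rw [← sub_add_cancel x y]
      exact Submodule.add_mem _ (cspan_mono h2 hxy) (subset_cspan hy)
    · refine Submodule.span_le.2 fun y hy => ?_
      obtain ⟨x, hx, hxy⟩ := e2 y hy
      rw [← sub_sub_cancel x y]
      exact Submodule.sub_mem _ (subset_cspan hx) (cspan_mono h1 (h ▸ hxy))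

/-! ### The poset of regions -/

theorem cdim_face_eq_iff [Finite ι] (x : E n) :
    cdim (A.face x) = n ↔ ∀ i, inner ℝ (A.normal i) x ≠ 0 := by
  constructor
  · intro h i hi
    have ht : cspan (A.face x) = ⊤ := by
      apply Submodule.eq_top_of_finrank_eq
      rw [finrank_euclideanSpace_fin]
      exact h
    have hm : A.normal i ∈ cspan (A.face x) := ht ▸ Submodule.mem_top
    exact A.normal_ne_zero i (inner_self_eq_zero.1 (A.mem_cspan_face.1 hm i hi))
  · intro h
    have ht : cspan (A.face x) = ⊤ := by
      rw [eq_top_iff]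
      exact fun z _ => A.mem_cspan_face.2 fun i hi => absurd hi (h i)
    rw [cdim, ht, finrank_top, finrank_euclideanSpace_fin]

/-- The region containing a point off all hyperplanes. -/
def region [Finite ι] (hA : A.IsSimplicial) (x : E n)
    (hx : ∀ i, inner ℝ (A.normal i) x ≠ 0) : (A.fan hA).Chamber :=
  ⟨⟨A.face x, x, rfl⟩, (A.cdim_face_eq_iff x).2 hx⟩

theorem exists_region [Finite ι] {hA : A.IsSimplicial} (R : (A.fan hA).Chamber) :
    ∃ x hx, R = A.region hA x hx := by
  obtain ⟨⟨_, x, rfl⟩, h⟩ := R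
  exact ⟨x, (A.cdim_face_eq_iff x).1 h, rfl⟩

/-- The `i`-th hyperplane separates two regions: they have points strictly on opposite sides. -/
def Separates [Finite ι] {hA : A.IsSimplicial} (i : ι) (R S : (A.fan hA).Chamber) : Prop :=
  ∃ x ∈ R.cone.1, ∃ y ∈ S.cone.1, inner ℝ (A.normal i) x < 0 ∧ 0 < inner ℝ (A.normal i) y ∨
    0 < inner ℝ (A.normal i) x ∧ inner ℝ (A.normal i) y < 0

theorem separates_iff [Finite ι] {hA : A.IsSimplicial} {i : ι} {x y : E n}
    (hx : ∀ i, inner ℝ (A.normal i) x ≠ 0) (hy : ∀ i, inner ℝ (A.normal i) y ≠ 0) :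
    A.Separates i (A.region hA x hx) (A.region hA y hy) ↔
      inner ℝ (A.normal i) x * inner ℝ (A.normal i) y < 0 := by
  constructor
  · rintro ⟨a, ha, b, hb, h⟩
    have ha' := ha i
    have hb' := hb i
    rcases (hx i).lt_or_gt with h1 | h1 <;> rcases (hy i).lt_or_gt with h2 | h2
    · have := ha'.2.2 h1; have := hb'.2.2 h2; rcases h with h | h <;> linarith
    · exact mul_neg_of_neg_of_pos h1 h2
    · exact mul_neg_of_pos_of_neg h1 h2
    · have := ha'.2.1 h1; have := hb'.2.1 h2; rcases h with h | h <;> linarith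
  · intro h
    refine ⟨x, A.self_mem_face x, y, A.self_mem_face y, ?_⟩
    rcases mul_neg_iff.1 h with h | h
    · exact Or.inr h
    · exact Or.inl h

/-- The separating set of `R` with respect to the base region `B`. -/
def sep [Finite ι] {hA : A.IsSimplicial} (B R : (A.fan hA).Chamber) : Set ι :=
  {i | A.Separates i R B}

theorem mem_sep [Finite ι] {hA : A.IsSimplicial} {i : ι} {b x : E n}
    (hb : ∀ i, inner ℝ (A.normal i) b ≠ 0) (hx : ∀ i, inner ℝ (A.normal i) x ≠ 0) :
    i ∈ A.sep (A.region hA b hb) (A.region hA x hx) ↔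
      inner ℝ (A.normal i) x * inner ℝ (A.normal i) b < 0 := A.separates_iff hx hb

theorem not_mem_sep [Finite ι] {hA : A.IsSimplicial} {i : ι} {b x : E n}
    (hb : ∀ i, inner ℝ (A.normal i) b ≠ 0) (hx : ∀ i, inner ℝ (A.normal i) x ≠ 0) :
    i ∉ A.sep (A.region hA b hb) (A.region hA x hx) ↔
      0 < inner ℝ (A.normal i) x * inner ℝ (A.normal i) b := by
  rw [mem_sep, not_lt]
  exact ⟨fun h => lt_of_le_of_ne h (mul_ne_zero (hx i) (hb i)).symm, le_of_lt⟩

theorem region_ext [Finite ι] {hA : A.IsSimplicial} {x y : E n}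
    (hx : ∀ i, inner ℝ (A.normal i) x ≠ 0) (hy : ∀ i, inner ℝ (A.normal i) y ≠ 0)
    (h : ∀ i, 0 < inner ℝ (A.normal i) x * inner ℝ (A.normal i) y) :
    A.region hA x hx = A.region hA y hy := by
  apply Subtype.ext
  apply Subtype.ext
  apply A.face_eq_of_sign
  intro i
  rcases mul_pos_iff.1 (h i) with h | h
  · rw [sign_pos h.1, sign_pos h.2]
  · rw [sign_neg h.1, sign_neg h.2]

/-- The order of the poset of regions with base region `B`: inclusion of separating sets. -/
@[reducible]
def regionOrder [Finite ι] {hA : A.IsSimplicial} (B : (A.fan hA).Chamber) :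
    PartialOrder (A.fan hA).Chamber where
  le R S := A.sep B R ⊆ A.sep B S
  le_refl R := Set.Subset.refl _
  le_trans R S T h h' := Set.Subset.trans h h'
  le_antisymm R S h h' := by
    obtain ⟨b, hb, rfl⟩ := A.exists_region B
    obtain ⟨x, hx, rfl⟩ := A.exists_region R
    obtain ⟨y, hy, rfl⟩ := A.exists_region S
    refine A.region_ext hx hy fun i => ?_
    have e := Set.ext_iff.1 (Set.Subset.antisymm h h') i
    rw [A.mem_sep, A.mem_sep] at e
    rcases (mul_ne_zero (hx i) (hb i)).lt_or_gt with h1 | h1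
    · have := mul_pos_of_neg_of_neg h1 (e.1 h1)
      nlinarith [mul_self_pos.2 (hb i)]
    · have h2 : 0 < inner ℝ (A.normal i) y * inner ℝ (A.normal i) b :=
        lt_of_le_of_ne (not_lt.1 fun h => absurd (e.2 h) h1.not_gt)
          (mul_ne_zero (hy i) (hb i)).symm
      have := mul_pos h1 h2
      nlinarith [mul_self_pos.2 (hb i)]

theorem regionOrder_le_iff [Finite ι] {hA : A.IsSimplicial} {b x y : E n}
    (hb : ∀ i, inner ℝ (A.normal i) b ≠ 0) (hx : ∀ i, inner ℝ (A.normal i) x ≠ 0)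
    (hy : ∀ i, inner ℝ (A.normal i) y ≠ 0) :
    (A.regionOrder (A.region hA b hb)).le (A.region hA x hx) (A.region hA y hy) ↔
      ∀ i, inner ℝ (A.normal i) x * inner ℝ (A.normal i) b < 0 →
        inner ℝ (A.normal i) y * inner ℝ (A.normal i) b < 0 := by
  constructor
  · intro h i hi
    exact (A.mem_sep hb hy).1 (h ((A.mem_sep hb hx).2 hi))
  · intro h i hi
    exact (A.mem_sep hb hy).2 (h i ((A.mem_sep hb hx).1 hi))

/-- Moving `y` slightly in the direction of a point `x` off all hyperplanes: the result lies off
all hyperplanes, on the same side as `y` where `y` is off, and as `x` where `y` is on. -/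
theorem exists_push [Finite ι] {x : E n} (hx : ∀ i, inner ℝ (A.normal i) x ≠ 0) (y : E n) :
    ∃ r : E n, ∀ i, inner ℝ (A.normal i) r ≠ 0 ∧
      (0 < inner ℝ (A.normal i) y → 0 < inner ℝ (A.normal i) r) ∧
      (inner ℝ (A.normal i) y < 0 → inner ℝ (A.normal i) r < 0) ∧
      (inner ℝ (A.normal i) y = 0 → 0 < inner ℝ (A.normal i) r * inner ℝ (A.normal i) x) := by
  obtain ⟨ε, hε, H⟩ := A.exists_eps y x
  refine ⟨y + ε • x, fun i => ?_⟩
  have hz : inner ℝ (A.normal i) y = 0 →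
      inner ℝ (A.normal i) (y + ε • x) = ε * inner ℝ (A.normal i) x := by
    intro e
    rw [inner_add_right, real_inner_smul_right, e, zero_add]
  refine ⟨?_, (H i).1, (H i).2, fun e => ?_⟩
  · rcases lt_trichotomy (inner ℝ (A.normal i) y) 0 with h | h | h
    · exact ((H i).2 h).ne
    · rw [hz h]; exact mul_ne_zero hε.ne' (hx i)
    · exact ((H i).1 h).ne'
  · rw [hz e, mul_assoc]
    exact mul_pos hε (mul_self_pos.2 (hx i))

theorem mem_face_of_push {y r : E n} (h : ∀ i, inner ℝ (A.normal i) r ≠ 0 ∧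
      (0 < inner ℝ (A.normal i) y → 0 < inner ℝ (A.normal i) r) ∧
      (inner ℝ (A.normal i) y < 0 → inner ℝ (A.normal i) r < 0)) : y ∈ A.face r := by
  intro i
  obtain ⟨h1, h2, h3⟩ := h i
  refine ⟨fun e => absurd e h1, fun e => ?_, fun e => ?_⟩
  · by_contra hc; exact absurd e (h3 (not_le.1 hc)).not_gt
  · by_contra hc; exact absurd e (h2 (not_le.1 hc)).not_gt

theorem mem_face_regular {x y : E n} (hx : ∀ i, inner ℝ (A.normal i) x ≠ 0) :
    y ∈ A.face x ↔ ∀ i, 0 ≤ inner ℝ (A.normal i) y * inner ℝ (A.normal i) x := by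
  constructor
  · intro h i
    rcases (hx i).lt_or_gt with h1 | h1
    · exact mul_nonneg_of_nonpos_of_nonpos ((h i).2.2 h1) h1.le
    · exact mul_nonneg ((h i).2.1 h1) h1.le
  · intro h i
    exact ⟨fun e => absurd e (hx i), fun e => nonneg_of_mul_nonneg_left (h i) e,
      fun e => nonpos_of_mul_nonneg_left (h i) e⟩

theorem regionOrder_facial [Finite ι] {hA : A.IsSimplicial} (B : (A.fan hA).Chamber)
    (σ : (A.fan hA).Cone) : ∃ lo hi : (A.fan hA).Chamber, (A.regionOrder B).le lo hi ∧
      ∀ τ : (A.fan hA).Chamber, σ ≤ τ.cone ↔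
        (A.regionOrder B).le lo τ ∧ (A.regionOrder B).le τ hi := by
  obtain ⟨b, hb, rfl⟩ := A.exists_region B
  obtain ⟨_, s, rfl⟩ := σ
  have hb' : ∀ i, inner ℝ (A.normal i) (-b) ≠ 0 := fun i => by
    rw [inner_neg_right]; exact neg_ne_zero.2 (hb i)
  obtain ⟨l, hl⟩ := A.exists_push hb s
  obtain ⟨u, hu⟩ := A.exists_push hb' s
  have hl0 := fun i => (hl i).1
  have hu0 := fun i => (hu i).1
  have hu4 : ∀ i, inner ℝ (A.normal i) s = 0 →
      inner ℝ (A.normal i) u * inner ℝ (A.normal i) b < 0 := by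
    intro i e
    have := (hu i).2.2.2 e
    rw [inner_neg_right] at this
    linarith
  refine ⟨A.region hA l hl0, A.region hA u hu0, ?_, fun τ => ?_⟩
  · rw [A.regionOrder_le_iff]
    intro i hi
    rcases lt_trichotomy (inner ℝ (A.normal i) s) 0 with h | h | h
    · have h1 := (hl i).2.2.1 h
      have h2 := (hu i).2.2.1 h
      have := pos_of_mul_neg_right hi h1.le
      exact mul_neg_of_neg_of_pos h2 this
    · exact hu4 i h
    · have h1 := (hl i).2.1 h
      have h2 := (hu i).2.1 h
      have := neg_of_mul_neg_right hi h1.le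
      exact mul_neg_of_pos_of_neg h2 this
  · obtain ⟨t, ht, rfl⟩ := A.exists_region τ
    rw [A.regionOrder_le_iff, A.regionOrder_le_iff]
    have e : (⟨A.face s, s, rfl⟩ : (A.fan hA).Cone) ≤ (A.region hA t ht).cone ↔
        s ∈ A.face t := ⟨fun h => h (A.self_mem_face s), fun h => A.face_le h⟩
    rw [e, A.mem_face_regular ht]
    constructor
    · intro h
      refine ⟨fun i hi => ?_, fun i hi => ?_⟩
      · rcases lt_trichotomy (inner ℝ (A.normal i) s) 0 with h0 | h0 | h0
        · have h1 := (hl i).2.2.1 h0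
          have h2 : inner ℝ (A.normal i) t < 0 :=
            lt_of_le_of_ne (nonpos_of_mul_nonneg_right (h i) h0) (ht i)
          exact mul_neg_of_neg_of_pos h2 (pos_of_mul_neg_right hi h1.le)
        · exact absurd hi ((hl i).2.2.2 h0).not_gt
        · have h1 := (hl i).2.1 h0
          have h2 : 0 < inner ℝ (A.normal i) t :=
            lt_of_le_of_ne (nonneg_of_mul_nonneg_right (h i) h0) (ht i).symm
          exact mul_neg_of_pos_of_neg h2 (neg_of_mul_neg_right hi h1.le)
      · rcases lt_trichotomy (inner ℝ (A.normal i) s) 0 with h0 | h0 | h0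
        · have h1 := (hu i).2.2.1 h0
          have h2 : inner ℝ (A.normal i) t < 0 :=
            lt_of_le_of_ne (nonpos_of_mul_nonneg_right (h i) h0) (ht i)
          exact mul_neg_of_neg_of_pos h1 (pos_of_mul_neg_right hi h2.le)
        · exact hu4 i h0
        · have h1 := (hu i).2.1 h0
          have h2 : 0 < inner ℝ (A.normal i) t :=
            lt_of_le_of_ne (nonneg_of_mul_nonneg_right (h i) h0) (ht i).symm
          exact mul_neg_of_pos_of_neg h1 (neg_of_mul_neg_right hi h2.le)
    · rintro ⟨h1, h2⟩ i
      by_contra hc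
      rw [not_le] at hc
      have hb2 := mul_self_pos.2 (hb i)
      rcases mul_neg_iff.1 hc with ⟨hs, hti⟩ | ⟨hs, hti⟩
      · have a := (hl i).2.1 hs
        have c := (hu i).2.1 hs
        rcases (hb i).lt_or_gt with hbi | hbi
        · exact absurd (h1 i (mul_neg_of_pos_of_neg a hbi)) (mul_pos_of_neg_of_neg hti hbi).not_gt
        · exact absurd (h2 i (mul_neg_of_neg_of_pos hti hbi)) (mul_pos c hbi).not_gt
      · have a := (hl i).2.2.1 hs
        have c := (hu i).2.2.1 hs
        rcases (hb i).lt_or_gt with hbi | hbi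
        · exact absurd (h2 i (mul_neg_of_pos_of_neg hti hbi)) (mul_pos_of_neg_of_neg c hbi).not_gt
        · exact absurd (h1 i (mul_neg_of_neg_of_pos a hbi)) (mul_pos hti hbi).not_gt

theorem regionOrder_interval [Finite ι] {hA : A.IsSimplicial} (B a c : (A.fan hA).Chamber)
    (h : (A.regionOrder B).le a c) : ∃ S : Set (E n), S.Finite ∧
      {x | ∃ τ : (A.fan hA).Chamber, (A.regionOrder B).le a τ ∧ (A.regionOrder B).le τ c ∧
        x ∈ τ.cone.1} = (PointedCone.hull ℝ S : Set (E n)) := by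
  have hfin : Finite (A.fan hA).Cone := A.finite_faces
  have hfin' : Finite (A.fan hA).Chamber := Subtype.finite
  choose G hGfin hGli hG using fun τ : (A.fan hA).Chamber => hA τ.cone.1 τ.cone.2
  obtain ⟨b, hb, rfl⟩ := A.exists_region B
  obtain ⟨r, hr, rfl⟩ := A.exists_region a
  obtain ⟨s, hs, rfl⟩ := A.exists_region c
  let I : Set (A.fan hA).Chamber := {τ | (A.regionOrder (A.region hA b hb)).le (A.region hA r hr) τ ∧
    (A.regionOrder (A.region hA b hb)).le τ (A.region hA s hs)}
  refine ⟨⋃ τ ∈ I, G τ, (Set.toFinite I).biUnion fun τ _ => hGfin τ, ?_⟩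
  have hle := (A.regionOrder_le_iff hb hr hs).1 h
  let D : PointedCone ℝ (E n) :=
    { carrier := {y | ∀ i, 0 < inner ℝ (A.normal i) r * inner ℝ (A.normal i) s →
        0 ≤ inner ℝ (A.normal i) y * inner ℝ (A.normal i) r}
      add_mem' := by
        intro u v hu hv i hi
        rw [inner_add_right, add_mul]
        exact add_nonneg (hu i hi) (hv i hi)
      zero_mem' := by intro i _; simp
      smul_mem' := by
        intro k u hu i hi
        have e : inner ℝ (A.normal i) (k • u) = (k : ℝ) * inner ℝ (A.normal i) u :=
          real_inner_smul_right _ _ _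
        rw [e, mul_assoc]
        exact mul_nonneg k.2 (hu i hi) }
  have hpiece : ∀ τ ∈ I, τ.cone.1 ≤ D := by
    rintro τ ⟨h1, h2⟩ y hy i hi
    obtain ⟨t, ht, rfl⟩ := A.exists_region τ
    have h1' := (A.regionOrder_le_iff hb hr ht).1 h1 i
    have h2' := (A.regionOrder_le_iff hb ht hs).1 h2 i
    have hy' := (A.mem_face_regular ht).1 hy i
    have hti := ht i
    have hbi := hb i
    generalize (inner ℝ (A.normal i) y : ℝ) = y' at *
    generalize (inner ℝ (A.normal i) t : ℝ) = t' at *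
    generalize (inner ℝ (A.normal i) r : ℝ) = r' at *
    generalize (inner ℝ (A.normal i) s : ℝ) = s' at *
    generalize (inner ℝ (A.normal i) b : ℝ) = b' at *
    rcases mul_pos_iff.1 hi with ⟨hr0, hs0⟩ | ⟨hr0, hs0⟩ <;> rcases hbi.lt_or_gt with hb0 | hb0
    · have ht0 : 0 < t' := by
        by_contra hc
        exact absurd (h1' (mul_neg_of_pos_of_neg hr0 hb0))
          (not_lt.2 (mul_nonneg_of_nonpos_of_nonpos (not_lt.1 hc) hb0.le))
      exact mul_nonneg (nonneg_of_mul_nonneg_left hy' ht0) hr0.le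
    · have ht0 : 0 < t' := by
        by_contra hc
        exact absurd (h2' (mul_neg_of_neg_of_pos (lt_of_le_of_ne (not_lt.1 hc) hti) hb0))
          (mul_pos hs0 hb0).not_gt
      exact mul_nonneg (nonneg_of_mul_nonneg_left hy' ht0) hr0.le
    · have ht0 : t' < 0 := by
        by_contra hc
        exact absurd (h2' (mul_neg_of_pos_of_neg (lt_of_le_of_ne (not_lt.1 hc) hti.symm) hb0))
          (mul_pos_of_neg_of_neg hs0 hb0).not_gt
      exact mul_nonneg_of_nonpos_of_nonpos (nonpos_of_mul_nonneg_left hy' ht0) hr0.le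
    · have ht0 : t' < 0 := by
        by_contra hc
        exact absurd (h1' (mul_neg_of_neg_of_pos hr0 hb0))
          (not_lt.2 (mul_nonneg (not_lt.1 hc) hb0.le))
      exact mul_nonneg_of_nonpos_of_nonpos (nonpos_of_mul_nonneg_left hy' ht0) hr0.le
  apply Set.Subset.antisymm
  · rintro x ⟨τ, h1, h2, hx⟩
    have : (PointedCone.hull ℝ (G τ)) ≤ PointedCone.hull ℝ (⋃ τ ∈ I, G τ) :=
      Submodule.span_mono (Set.subset_biUnion_of_mem (u := fun τ => G τ) (show τ ∈ I from ⟨h1, h2⟩))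
    exact this (by rw [hG τ]; exact hx)
  · have hD : PointedCone.hull ℝ (⋃ τ ∈ I, G τ) ≤ D := by
      refine Submodule.span_le.2 (Set.iUnion₂_subset fun τ hτ => ?_)
      intro y hy
      refine hpiece τ hτ ?_
      rw [← hG τ]
      exact PointedCone.subset_hull hy
    intro y hy
    have hyD := hD hy
    obtain ⟨t, ht⟩ := A.exists_push hr y
    have ht0 := fun i => (ht i).1
    refine ⟨A.region hA t ht0, ?_, ?_, A.mem_face_of_push fun i =>
      ⟨(ht i).1, (ht i).2.1, (ht i).2.2.1⟩⟩
    all_goals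
      rw [A.regionOrder_le_iff]
      intro i hi
      have hyi := hyD i
      have hti := ht i
      have hlei := hle i
      have hri := hr i
      have hsi := hs i
      have hbi := hb i
      clear hyD ht hle
      generalize (inner ℝ (A.normal i) y : ℝ) = y' at *
      generalize (inner ℝ (A.normal i) t : ℝ) = t' at *
      generalize (inner ℝ (A.normal i) r : ℝ) = r' at *
      generalize (inner ℝ (A.normal i) s : ℝ) = s' at *
      generalize (inner ℝ (A.normal i) b : ℝ) = b' at *
      have key : 0 < r' * s' → 0 < t' * r' := by
        intro h0
        have h1 := hyi h0
        rcases lt_trichotomy y' 0 with h2 | h2 | h2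
        · exact mul_pos_of_neg_of_neg (hti.2.2.1 h2)
            (lt_of_le_of_ne (nonpos_of_mul_nonneg_right h1 h2) hri)
        · exact hti.2.2.2 h2
        · exact mul_pos (hti.2.1 h2)
            (lt_of_le_of_ne (nonneg_of_mul_nonneg_right h1 h2) hri.symm)
    · have h1 := hlei hi
      have h2 : 0 < r' * s' := by
        have := mul_pos_of_neg_of_neg hi h1
        nlinarith [mul_self_pos.2 hbi]
      have h3 := key h2
      rcases hri.lt_or_gt with h4 | h4
      · exact mul_neg_of_neg_of_pos (neg_of_mul_pos_left h3 h4.le) (pos_of_mul_neg_right hi h4.le)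
      · exact mul_neg_of_pos_of_neg (pos_of_mul_pos_left h3 h4.le) (neg_of_mul_neg_right hi h4.le)
    · by_contra hc
      have h1 : 0 < s' * b' := lt_of_le_of_ne (not_lt.1 hc) (mul_ne_zero hsi hbi).symm
      have h0 : 0 < r' * b' := lt_of_le_of_ne (not_lt.1 fun h => hc (hlei h))
        (mul_ne_zero hri hbi).symm
      have h2 : 0 < r' * s' := by
        have := mul_pos h0 h1
        nlinarith [mul_self_pos.2 hbi]
      have h3 := key h2
      have := mul_pos h3 h0
      nlinarith [mul_self_pos.2 hri]

theorem mul_neg_of_same_side {x y b : ℝ} (h : 0 < x * y) (h' : y * b < 0) : x * b < 0 := by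
  have h1 := mul_neg_of_pos_of_neg h h'
  by_contra hc
  nlinarith [mul_nonneg (mul_self_nonneg y) (not_lt.1 hc)]

theorem exists_crossing [Finite ι] {hA : A.IsSimplicial} {b r s : E n}
    (hb : ∀ i, inner ℝ (A.normal i) b ≠ 0) (hr : ∀ i, inner ℝ (A.normal i) r ≠ 0)
    (hs : ∀ i, inner ℝ (A.normal i) s ≠ 0)
    (hle : ∀ i, inner ℝ (A.normal i) r * inner ℝ (A.normal i) b < 0 →
      inner ℝ (A.normal i) s * inner ℝ (A.normal i) b < 0)
    (hne : ∃ i, inner ℝ (A.normal i) r * inner ℝ (A.normal i) s < 0)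
    (hcov : ∀ q (hq : ∀ i, inner ℝ (A.normal i) q ≠ 0),
      (A.regionOrder (A.region hA b hb)).le (A.region hA r hr) (A.region hA q hq) →
      (A.regionOrder (A.region hA b hb)).le (A.region hA q hq) (A.region hA s hs) →
      (∀ i, 0 < inner ℝ (A.normal i) q * inner ℝ (A.normal i) r) ∨
      (∀ i, 0 < inner ℝ (A.normal i) q * inner ℝ (A.normal i) s)) :
    ∃ t : ℝ, 0 < t ∧ t < 1 ∧
      (∀ i, inner ℝ (A.normal i) r * inner ℝ (A.normal i) s < 0 →
        inner ℝ (A.normal i) ((1 - t) • r + t • s) = 0) ∧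
      (∀ i, 0 < inner ℝ (A.normal i) r * inner ℝ (A.normal i) s →
        0 < inner ℝ (A.normal i) ((1 - t) • r + t • s) * inner ℝ (A.normal i) r) := by
  classical
  have := Fintype.ofFinite ι
  let T : ι → ℝ := fun i =>
    inner ℝ (A.normal i) r / (inner ℝ (A.normal i) r - inner ℝ (A.normal i) s)
  obtain ⟨i₀, hi₀, hmin⟩ := Finset.exists_min_image
    (Finset.univ.filter fun i => inner ℝ (A.normal i) r * inner ℝ (A.normal i) s < 0) T
    (by obtain ⟨i, hi⟩ := hne; exact ⟨i, by simpa using hi⟩)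
  have hi₀' : inner ℝ (A.normal i₀) r * inner ℝ (A.normal i₀) s < 0 := by simpa using hi₀
  have hT : ∀ i, inner ℝ (A.normal i) r * inner ℝ (A.normal i) s < 0 → 0 < T i ∧ T i < 1 ∧
      T i * (inner ℝ (A.normal i) r - inner ℝ (A.normal i) s) = inner ℝ (A.normal i) r ∧
      0 < (inner ℝ (A.normal i) r - inner ℝ (A.normal i) s) * inner ℝ (A.normal i) r := by
    intro i hi
    rcases mul_neg_iff.1 hi with ⟨h1, h2⟩ | ⟨h1, h2⟩
    · have h3 : 0 < inner ℝ (A.normal i) r - inner ℝ (A.normal i) s := by linarith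
      refine ⟨div_pos h1 h3, (div_lt_one h3).2 (by linarith), div_mul_cancel₀ _ h3.ne',
        mul_pos h3 h1⟩
    · have h3 : inner ℝ (A.normal i) r - inner ℝ (A.normal i) s < 0 := by linarith
      refine ⟨div_pos_of_neg_of_neg h1 h3, (div_lt_one_of_neg h3).2 (by linarith),
        div_mul_cancel₀ _ h3.ne, mul_pos_of_neg_of_neg h3 h1⟩
  obtain ⟨t0, t1, te, -⟩ := hT i₀ hi₀'
  have hp : ∀ i, inner ℝ (A.normal i) ((1 - T i₀) • r + T i₀ • s) =
      (1 - T i₀) * inner ℝ (A.normal i) r + T i₀ * inner ℝ (A.normal i) s := by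
    intro i
    rw [inner_add_right, real_inner_smul_right, real_inner_smul_right]
  have hsame : ∀ i, 0 < inner ℝ (A.normal i) r * inner ℝ (A.normal i) s →
      0 < inner ℝ (A.normal i) ((1 - T i₀) • r + T i₀ • s) * inner ℝ (A.normal i) r := by
    intro i hi
    rw [hp]
    have h1 := mul_self_pos.2 (hr i)
    have e : ((1 - T i₀) * inner ℝ (A.normal i) r + T i₀ * inner ℝ (A.normal i) s) *
        inner ℝ (A.normal i) r = (1 - T i₀) * (inner ℝ (A.normal i) r * inner ℝ (A.normal i) r) +
        T i₀ * (inner ℝ (A.normal i) r * inner ℝ (A.normal i) s) := by ring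
    rw [e]
    exact add_pos (mul_pos (by linarith) h1) (mul_pos t0 hi)
  have hdiff : ∀ i, inner ℝ (A.normal i) r * inner ℝ (A.normal i) s < 0 →
      0 ≤ inner ℝ (A.normal i) ((1 - T i₀) • r + T i₀ • s) * inner ℝ (A.normal i) r := by
    intro i hi
    obtain ⟨-, -, e, hpos⟩ := hT i hi
    have hm := hmin i (by simpa using hi)
    have e2 : inner ℝ (A.normal i) ((1 - T i₀) • r + T i₀ • s) * inner ℝ (A.normal i) r =
        (T i - T i₀) * ((inner ℝ (A.normal i) r - inner ℝ (A.normal i) s) *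
          inner ℝ (A.normal i) r) := by
      rw [hp]
      linear_combination (-inner ℝ (A.normal i) r) * e
    rw [e2]
    exact mul_nonneg (by linarith) hpos.le
  refine ⟨T i₀, t0, t1, ?_, hsame⟩
  obtain ⟨q, hq⟩ := A.exists_push hs ((1 - T i₀) • r + T i₀ • s)
  have hq0 := fun i => (hq i).1
  have hpz : inner ℝ (A.normal i₀) ((1 - T i₀) • r + T i₀ • s) = 0 := by
    rw [hp]; linear_combination -te
  -- the sign of `q` agrees with `r` where the sign of the crossing point does
  have hqp : ∀ i, 0 < inner ℝ (A.normal i) ((1 - T i₀) • r + T i₀ • s) * inner ℝ (A.normal i) r →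
      0 < inner ℝ (A.normal i) q * inner ℝ (A.normal i) r := by
    intro i hi
    rcases mul_pos_iff.1 hi with ⟨h1, h2⟩ | ⟨h1, h2⟩
    · exact mul_pos ((hq i).2.1 h1) h2
    · exact mul_pos_of_neg_of_neg ((hq i).2.2.1 h1) h2
  have hor : ∀ i, 0 < inner ℝ (A.normal i) q * inner ℝ (A.normal i) r ∨
      0 < inner ℝ (A.normal i) q * inner ℝ (A.normal i) s := by
    intro i
    rcases (mul_ne_zero (hr i) (hs i)).lt_or_gt with h | h
    · rcases (hdiff i h).eq_or_lt with h1 | h1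
      · exact Or.inr ((hq i).2.2.2 ((mul_eq_zero.1 h1.symm).resolve_right (hr i)))
      · exact Or.inl (hqp i h1)
    · exact Or.inl (hqp i (hsame i h))
  have hcase : ∀ i, (inner ℝ (A.normal i) r * inner ℝ (A.normal i) b < 0 →
        inner ℝ (A.normal i) q * inner ℝ (A.normal i) b < 0) ∧
      (inner ℝ (A.normal i) q * inner ℝ (A.normal i) b < 0 →
        inner ℝ (A.normal i) s * inner ℝ (A.normal i) b < 0) := by
    intro i
    have h2 := hle i
    rcases hor i with h1 | h1
    · exact ⟨fun h => mul_neg_of_same_side h1 h,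
        fun h => h2 (mul_neg_of_same_side (by rwa [mul_comm]) h)⟩
    · exact ⟨fun h => mul_neg_of_same_side h1 (h2 h),
        fun h => mul_neg_of_same_side (by rwa [mul_comm]) h⟩
  have hcov' := hcov q hq0 ((A.regionOrder_le_iff hb hr hq0).2 fun i => (hcase i).1)
    ((A.regionOrder_le_iff hb hq0 hs).2 fun i => (hcase i).2)
  have hqs : ∀ i, 0 < inner ℝ (A.normal i) q * inner ℝ (A.normal i) s := by
    rcases hcov' with h | h
    · have h1 := h i₀
      have h2 := (hq i₀).2.2.2 hpz
      have h3 := mul_pos h1 h2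
      have h4 := mul_self_pos.2 (hq0 i₀)
      nlinarith
    · exact h
  intro i hi
  rcases (hdiff i hi).eq_or_lt with h1 | h1
  · exact (mul_eq_zero.1 h1.symm).resolve_right (hr i)
  · have h2 := mul_pos (hqp i h1) (hqs i)
    have h4 := mul_self_pos.2 (hq0 i)
    nlinarith

theorem regionOrder_covers [Finite ι] {hA : A.IsSimplicial} (B a c : (A.fan hA).Chamber)
    (hlt : (A.regionOrder B).lt a c)
    (hcov : ∀ q, (A.regionOrder B).le a q → (A.regionOrder B).le q c → q = a ∨ q = c) :
    cdim (a.cone.1 ⊓ c.cone.1) + 1 = n := by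
  obtain ⟨b, hb, rfl⟩ := A.exists_region B
  obtain ⟨r, hr, rfl⟩ := A.exists_region a
  obtain ⟨s, hs, rfl⟩ := A.exists_region c
  have hle := (A.regionOrder_le_iff hb hr hs).1
    ((A.regionOrder (A.region hA b hb)).lt_iff_le_not_ge _ _ |>.1 hlt).1
  have hne : ∃ i, inner ℝ (A.normal i) r * inner ℝ (A.normal i) s < 0 := by
    by_contra hc
    push Not at hc
    have : A.region hA r hr = A.region hA s hs := A.region_ext hr hs fun i =>
      lt_of_le_of_ne (hc i) (mul_ne_zero (hr i) (hs i)).symm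
    rw [this] at hlt
    exact (A.regionOrder (A.region hA b hb)).lt_iff_le_not_ge _ _ |>.1 hlt |>.2 (Set.Subset.refl _)
  have hreg : ∀ {x y : E n} (hx : ∀ i, inner ℝ (A.normal i) x ≠ 0)
      (hy : ∀ i, inner ℝ (A.normal i) y ≠ 0), A.region hA x hx = A.region hA y hy →
      ∀ i, 0 < inner ℝ (A.normal i) x * inner ℝ (A.normal i) y := by
    intro x y hx hy h i
    have h1 : x ∈ A.face y := by
      have : A.face x = A.face y := congrArg (fun R => R.cone.1) h
      rw [← this]; exact A.self_mem_face x
    exact lt_of_le_of_ne ((A.mem_face_regular hy).1 h1 i) (mul_ne_zero (hx i) (hy i)).symm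
  -- crossing towards any interior point of the upper region
  have cross : ∀ s' (hs' : ∀ i, inner ℝ (A.normal i) s' ≠ 0),
      (∀ i, 0 < inner ℝ (A.normal i) s' * inner ℝ (A.normal i) s) → ∃ t : ℝ, 0 < t ∧ t < 1 ∧
      (∀ i, inner ℝ (A.normal i) r * inner ℝ (A.normal i) s < 0 →
        inner ℝ (A.normal i) ((1 - t) • r + t • s') = 0) ∧
      (∀ i, 0 < inner ℝ (A.normal i) r * inner ℝ (A.normal i) s →
        0 < inner ℝ (A.normal i) ((1 - t) • r + t • s') * inner ℝ (A.normal i) r) := by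
    intro s' hs' hss
    have e : A.region hA s' hs' = A.region hA s hs := A.region_ext hs' hs hss
    have hneg : ∀ i, (inner ℝ (A.normal i) r * inner ℝ (A.normal i) s' < 0 ↔
        inner ℝ (A.normal i) r * inner ℝ (A.normal i) s < 0) := by
      intro i
      rcases mul_pos_iff.1 (hss i) with ⟨h1, h2⟩ | ⟨h1, h2⟩
      · simp [mul_neg_iff, h1, h2, h1.not_gt, h2.not_gt]
      · simp [mul_neg_iff, h1, h2, h1.not_gt, h2.not_gt]
    have hpos : ∀ i, (0 < inner ℝ (A.normal i) r * inner ℝ (A.normal i) s →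
        0 < inner ℝ (A.normal i) r * inner ℝ (A.normal i) s') := by
      intro i h
      exact lt_of_le_of_ne (not_lt.1 fun h' => absurd h ((hneg i).1 h').not_gt)
        (mul_ne_zero (hr i) (hs' i)).symm
    obtain ⟨t, t0, t1, h1, h2⟩ := A.exists_crossing (hA := hA) hb hr hs'
      ((A.regionOrder_le_iff hb hr hs').1 (by
        rw [e]; exact (A.regionOrder_le_iff hb hr hs).2 hle))
      (by obtain ⟨i, hi⟩ := hne; exact ⟨i, (hneg i).2 hi⟩)
      (by
        intro q hq h1 h2
        rw [e] at h2
        rcases hcov _ h1 h2 with h | h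
        · exact Or.inl (hreg hq hr h)
        · exact Or.inr (hreg hq hs' (h.trans e.symm)))
    exact ⟨t, t0, t1, fun i hi => h1 i ((hneg i).2 hi), fun i hi => h2 i (hpos i hi)⟩
  obtain ⟨i₀, hi₀⟩ := hne
  have huniq : ∀ j, inner ℝ (A.normal j) r * inner ℝ (A.normal j) s < 0 → j = i₀ := by
    intro j hj
    by_contra hji
    set m : E n := (inner ℝ (A.normal i₀) r : ℝ) • A.normal j -
      (inner ℝ (A.normal j) r : ℝ) • A.normal i₀ with hm
    have hm0 : m ≠ 0 := by
      intro h0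
      rw [hm, sub_eq_zero] at h0
      apply hji
      apply A.hyperplane_injective
      change (Submodule.span ℝ {A.normal j})ᗮ = (Submodule.span ℝ {A.normal i₀})ᗮ
      congr 1
      have e1 := Submodule.span_singleton_smul_eq (R := ℝ)
        (isUnit_iff_ne_zero.2 (hr i₀)) (A.normal j)
      have e2 := Submodule.span_singleton_smul_eq (R := ℝ)
        (isUnit_iff_ne_zero.2 (hr j)) (A.normal i₀)
      rw [← e1, ← e2, h0]
    obtain ⟨s', hs's, hms⟩ : ∃ s' : E n,
        (∀ i, 0 < inner ℝ (A.normal i) s' * inner ℝ (A.normal i) s) ∧ inner ℝ m s' ≠ 0 := by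
      by_cases h : inner ℝ m s = 0
      · obtain ⟨ε, hε, H⟩ := A.exists_eps s m
        refine ⟨s + ε • m, fun i => ?_, ?_⟩
        · rcases (hs i).lt_or_gt with h1 | h1
          · exact mul_pos_of_neg_of_neg ((H i).2 h1) h1
          · exact mul_pos ((H i).1 h1) h1
        · rw [inner_add_right, real_inner_smul_right, h, zero_add]
          exact mul_ne_zero hε.ne' (inner_self_ne_zero.2 hm0)
      · exact ⟨s, fun i => mul_self_pos.2 (hs i), h⟩
    obtain ⟨t, t0, -, hz, -⟩ := cross s' (fun i h => by simpa [h] using hs's i) hs's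
    have z1 := hz i₀ hi₀
    have z2 := hz j hj
    rw [inner_add_right, real_inner_smul_right, real_inner_smul_right] at z1 z2
    rw [hm, inner_sub_left, real_inner_smul_left, real_inner_smul_left] at hms
    apply hms
    have : t * (inner ℝ (A.normal i₀) r * inner ℝ (A.normal j) s' -
        inner ℝ (A.normal j) r * inner ℝ (A.normal i₀) s') = 0 := by
      linear_combination (inner ℝ (A.normal i₀) r) * z2 - (inner ℝ (A.normal j) r) * z1
    exact (mul_eq_zero.1 this).resolve_left t0.ne'
  obtain ⟨t, t0, t1, hz, hp⟩ := cross s hs fun i => mul_self_pos.2 (hs i)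
  set p : E n := (1 - t) • r + t • s with hpdef
  have hpos : ∀ i, i ≠ i₀ → 0 < inner ℝ (A.normal i) r * inner ℝ (A.normal i) s := fun i hi =>
    lt_of_le_of_ne (not_lt.1 fun h => hi (huniq i h)) (mul_ne_zero (hr i) (hs i)).symm
  have hpz : ∀ i, inner ℝ (A.normal i) p = 0 ↔ i = i₀ := by
    intro i
    constructor
    · intro h
      by_contra hi
      have := hp i (hpos i hi)
      rw [h, zero_mul] at this
      exact lt_irrefl _ this
    · rintro rfl
      exact hz _ hi₀
  have hps : ∀ i, 0 ≤ inner ℝ (A.normal i) p * inner ℝ (A.normal i) r ∧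
      0 ≤ inner ℝ (A.normal i) p * inner ℝ (A.normal i) s := by
    intro i
    by_cases hi : i = i₀
    · rw [(hpz i).2 hi]; simp
    · have h1 := hp i (hpos i hi)
      have h2 := hpos i hi
      refine ⟨h1.le, ?_⟩
      have h3 := mul_pos h1 h2
      nlinarith [mul_self_pos.2 (hr i)]
  have hface : A.face r ⊓ A.face s = A.face p := by
    apply le_antisymm
    · rintro y ⟨hyr, hys⟩ i
      have h1 := (A.mem_face_regular hr).1 hyr i
      have h2 := (A.mem_face_regular hs).1 hys i
      by_cases hi : i = i₀
      · subst hi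
        have h0 : inner ℝ (A.normal i) y = 0 := by
          rcases mul_neg_iff.1 hi₀ with ⟨h3, h4⟩ | ⟨h3, h4⟩
          · exact le_antisymm (nonpos_of_mul_nonneg_left h2 h4) (nonneg_of_mul_nonneg_left h1 h3)
          · exact le_antisymm (nonpos_of_mul_nonneg_left h1 h3) (nonneg_of_mul_nonneg_left h2 h4)
        simp [h0]
      · have h3 := hp i (hpos i hi)
        refine ⟨fun e => absurd ((hpz i).1 e) hi, fun e => ?_, fun e => ?_⟩
        · exact nonneg_of_mul_nonneg_left h1 (pos_of_mul_pos_right h3 e.le)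
        · exact nonpos_of_mul_nonneg_left h1 (neg_of_mul_pos_right h3 e.le)
    · exact le_inf (A.face_le ((A.mem_face_regular hr).2 fun i => (hps i).1))
        (A.face_le ((A.mem_face_regular hs).2 fun i => (hps i).2))
  change cdim (A.face r ⊓ A.face s) + 1 = n
  rw [hface, cdim]
  have hsp : cspan (A.face p) = (Submodule.span ℝ {A.normal i₀})ᗮ := by
    ext z
    rw [A.mem_cspan_face, Submodule.mem_orthogonal_singleton_iff_inner_right]
    exact ⟨fun h => h i₀ ((hpz i₀).2 rfl), fun h i hi => by rw [(hpz i).1 hi]; exact h⟩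
  rw [hsp]
  have h1 := (Submodule.span ℝ {A.normal i₀}).finrank_add_finrank_orthogonal
  rw [finrank_span_singleton (A.normal_ne_zero i₀), finrank_euclideanSpace_fin] at h1
  omega

/-- The poset of regions with base region `B`, as a fan poset. -/
def posetOfRegions [Finite ι] {hA : A.IsSimplicial} (B : (A.fan hA).Chamber) :
    FanPoset (A.fan hA) where
  finite := A.finite_faces
  complete x := ⟨A.face x, ⟨x, rfl⟩, A.self_mem_face x⟩
  order := A.regionOrder B
  interval_polyhedral a c h := A.regionOrder_interval B a c h
  facial σ := A.regionOrder_facial B σ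
  covers_dim a c h := A.regionOrder_covers B a c
    (let _ := A.regionOrder B; CovBy.lt h) fun _ h1 h2 =>
      (let _ := A.regionOrder B; (CovBy.eq_or_eq h h1 h2))

end Arrangement

/-! ### The arrangement with seven hyperplanes in `ℝ³` -/

/-- The coordinates of the seven normal vectors. -/
def normals7 : Fin 7 → Fin 3 → ℤ :=
  ![![1, 0, 0], ![0, 1, 0], ![0, 0, 1], ![1, 1, 0], ![0, 1, 1], ![1, 0, 1], ![1, 1, 1]]

/-- The normal vectors in `ℝ³`. -/
def normal7 (i : Fin 7) : E 3 := WithLp.toLp 2 fun k => (normals7 i k : ℝ)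

theorem inner_normal7 (i : Fin 7) (x : E 3) :
    inner ℝ (normal7 i) x = ∑ k, (normals7 i k : ℝ) * x k := by
  rw [PiLp.inner_apply]
  refine Finset.sum_congr rfl fun k _ => ?_
  simp [normal7, mul_comm]

/-- The arrangement of the seven hyperplanes in `ℝ³` whose normals are the nonzero `0/1`-vectors. -/
def arr7 : Arrangement 3 (Fin 7) where
  normal := normal7
  normal_ne_zero := by
    intro i h
    have h1 : ∃ k, normals7 i k ≠ 0 := by clear h; revert i; decide
    obtain ⟨k, hk⟩ := h1
    have h2 : (normal7 i) k = 0 := by rw [h]; rfl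
    have h3 : ((normals7 i k : ℤ) : ℝ) = 0 := h2
    exact hk (by exact_mod_cast h3)
  hyperplane_injective := by
    intro i j h
    by_contra hij
    have h1 : ∃ v : Fin 3 → Fin 3, (∑ k, normals7 i k * ((v k : ℕ) - 1 : ℤ)) = 0 ∧
        (∑ k, normals7 j k * ((v k : ℕ) - 1 : ℤ)) ≠ 0 := by
      clear h; revert i j; decide
    obtain ⟨v, hv1, hv2⟩ := h1
    let w : E 3 := WithLp.toLp 2 fun k => ((((v k : ℕ) - 1 : ℤ)) : ℝ)
    have hw : ∀ i, inner ℝ (normal7 i) w = ((∑ k, normals7 i k * ((v k : ℕ) - 1 : ℤ) : ℤ) : ℝ) := by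
      intro i
      rw [inner_normal7]
      push_cast
      simp [w]
    have h2 : w ∈ (Submodule.span ℝ {normal7 i})ᗮ :=
      Submodule.mem_orthogonal_singleton_iff_inner_right.2 (by rw [hw, hv1]; simp)
    rw [show (Submodule.span ℝ {normal7 i})ᗮ = (Submodule.span ℝ {normal7 j})ᗮ from h,
      Submodule.mem_orthogonal_singleton_iff_inner_right, hw] at h2
    exact hv2 (by exact_mod_cast h2)

/-- `V` lists the generators of a region, with walls `l` and signs `s`. -/
def RegionData (l : Fin 3 → Fin 7) (s : Fin 3 → ℤ) (V : Fin 3 → Fin 3 → ℤ) : Prop :=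
  (∀ k m, s k * ∑ j, normals7 (l k) j * V m j = if k = m then 1 else 0) ∧
  ∀ i, (∀ k, 0 ≤ ∑ j, normals7 i j * V k j) ∨ (∀ k, ∑ j, normals7 i j * V k j ≤ 0)

instance (l : Fin 3 → Fin 7) (s : Fin 3 → ℤ) (V : Fin 3 → Fin 3 → ℤ) :
    Decidable (RegionData l s V) := by unfold RegionData; infer_instance

theorem RegionData.neg {l : Fin 3 → Fin 7} {s : Fin 3 → ℤ} {V : Fin 3 → Fin 3 → ℤ}
    (h : RegionData l s V) : RegionData l (fun k => -s k) (fun k j => -V k j) := by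
  refine ⟨fun k m => ?_, fun i => ?_⟩
  · rw [← h.1 k m]
    simp
  · rcases h.2 i with h1 | h1
    · exact Or.inr fun k => by simpa using h1 k
    · exact Or.inl fun k => by simpa using h1 k

theorem RegionData.isSimplicial {l : Fin 3 → Fin 7} {s : Fin 3 → ℤ} {V : Fin 3 → Fin 3 → ℤ}
    (h : RegionData l s V) {x : E 3} (hx : ∀ k, 0 ≤ (s k : ℝ) * inner ℝ (normal7 (l k)) x) :
    (arr7.face x).IsSimplicial := by
  let v : Fin 3 → E 3 := fun m => WithLp.toLp 2 fun j => (V m j : ℝ)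
  have hv : ∀ i m, inner ℝ (normal7 i) (v m) = ((∑ j, normals7 i j * V m j : ℤ) : ℝ) := by
    intro i m
    rw [inner_normal7]
    push_cast
    rfl
  have hdual : ∀ k m, (s k : ℝ) * inner ℝ (normal7 (l k)) (v m) = if k = m then 1 else 0 := by
    intro k m
    rw [hv]
    have := h.1 k m
    split_ifs at this ⊢ with hkm
    · exact_mod_cast this
    · exact_mod_cast this
  have hcoord : ∀ (c : Fin 3 → ℝ) (k : Fin 3),
      (s k : ℝ) * inner ℝ (normal7 (l k)) (∑ m, c m • v m) = c k := by
    intro c k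
    rw [inner_sum, Finset.mul_sum]
    simp only [real_inner_smul_right]
    rw [Finset.sum_eq_single k]
    · have := hdual k k
      rw [if_pos rfl] at this
      linear_combination (c k) * this
    · intro m _ hm
      have := hdual k m
      rw [if_neg hm.symm] at this
      linear_combination (c m) * this
    · simp
  have hli : LinearIndependent ℝ v := by
    rw [Fintype.linearIndependent_iff]
    intro c hc k
    rw [← hcoord c k, hc]
    simp
  have hspan : ∀ y : E 3, y = ∑ m, ((s m : ℝ) * inner ℝ (normal7 (l m)) y) • v m := by
    intro y
    have htop : ⊤ ≤ Submodule.span ℝ (Set.range v) := by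
      rw [hli.span_eq_top_of_card_eq_finrank (by simp)]
    obtain ⟨c, hc⟩ := (Submodule.mem_span_range_iff_exists_fun ℝ).1 (htop (Submodule.mem_top (x := y)))
    rw [← hc]
    simp only [hcoord]
  have hs0 : ∀ k, (s k : ℝ) ≠ 0 := by
    intro k hk
    have := hdual k k
    rw [hk] at this
    simp at this
  have hsum : ∀ i, inner ℝ (normal7 i) x =
      ∑ m, ((s m : ℝ) * inner ℝ (normal7 (l m)) x) * inner ℝ (normal7 i) (v m) := by
    intro i
    conv_lhs => rw [hspan x]
    rw [inner_sum]
    simp only [real_inner_smul_right]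
  refine ⟨v '' {k | (s k : ℝ) * inner ℝ (normal7 (l k)) x ≠ 0}, Set.toFinite _, ?_, ?_⟩
  · exact (hli.linearIndepOn_id).mono (Set.image_subset_range _ _)
  · apply le_antisymm
    · refine Submodule.span_le.2 ?_
      rintro _ ⟨k, hk, rfl⟩ i
      change _ ≠ _ at hk
      have hk' := lt_of_le_of_ne (hx k) hk.symm
      change (inner ℝ (normal7 i) x = 0 → inner ℝ (normal7 i) (v k) = 0) ∧
        (0 < inner ℝ (normal7 i) x → 0 ≤ inner ℝ (normal7 i) (v k)) ∧
        (inner ℝ (normal7 i) x < 0 → inner ℝ (normal7 i) (v k) ≤ 0)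
      rcases h.2 i with h1 | h1
      · have h2 : ∀ m, 0 ≤ inner ℝ (normal7 i) (v m) := fun m => by
          rw [hv]; exact_mod_cast h1 m
        refine ⟨fun e => ?_, fun _ => h2 k, fun e => ?_⟩
        · rw [hsum] at e
          have := (Finset.sum_eq_zero_iff_of_nonneg
            (fun m _ => mul_nonneg (hx m) (h2 m))).1 e k (Finset.mem_univ _)
          exact (mul_eq_zero.1 this).resolve_left hk
        · rw [hsum] at e
          exact absurd e (not_lt.2 (Finset.sum_nonneg fun m _ => mul_nonneg (hx m) (h2 m)))
      · have h2 : ∀ m, inner ℝ (normal7 i) (v m) ≤ 0 := fun m => by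
          rw [hv]; exact_mod_cast h1 m
        refine ⟨fun e => ?_, fun e => ?_, fun _ => h2 k⟩
        · rw [hsum] at e
          have := (Finset.sum_eq_zero_iff_of_nonpos
            (fun m _ => mul_nonpos_of_nonneg_of_nonpos (hx m) (h2 m))).1 e k (Finset.mem_univ _)
          exact (mul_eq_zero.1 this).resolve_left hk
        · rw [hsum] at e
          exact absurd e (not_lt.2 (Finset.sum_nonpos
            fun m _ => mul_nonpos_of_nonneg_of_nonpos (hx m) (h2 m)))
    · intro y hy
      rw [hspan y]
      refine Submodule.sum_mem _ fun k _ => ?_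
      obtain ⟨y1, y2, y3⟩ : (inner ℝ (normal7 (l k)) x = 0 → inner ℝ (normal7 (l k)) y = 0) ∧
        (0 < inner ℝ (normal7 (l k)) x → 0 ≤ inner ℝ (normal7 (l k)) y) ∧
        (inner ℝ (normal7 (l k)) x < 0 → inner ℝ (normal7 (l k)) y ≤ 0) := hy (l k)
      by_cases hk : (s k : ℝ) * inner ℝ (normal7 (l k)) x = 0
      · rw [y1 ((mul_eq_zero.1 hk).resolve_left (hs0 k)), mul_zero, zero_smul]
        exact Submodule.zero_mem _
      · have hk' := lt_of_le_of_ne (hx k) (Ne.symm hk)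
        have hnn : 0 ≤ (s k : ℝ) * inner ℝ (normal7 (l k)) y := by
          rcases mul_pos_iff.1 hk' with ⟨h1, h2⟩ | ⟨h1, h2⟩
          · exact mul_nonneg h1.le (y2 h2)
          · exact mul_nonneg_of_nonpos_of_nonpos h1.le (y3 h2)
        exact PointedCone.smul_mem _ hnn (PointedCone.subset_hull ⟨k, hk, rfl⟩)

theorem isSimplicial_of_data {x : E 3} (l : Fin 3 → Fin 7) (s : Fin 3 → ℤ)
    (V : Fin 3 → Fin 3 → ℤ) (h : RegionData l s V)
    (hx : (∀ k, 0 ≤ (s k : ℝ) * ∑ j, (normals7 (l k) j : ℝ) * x j) ∨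
      (∀ k, (s k : ℝ) * ∑ j, (normals7 (l k) j : ℝ) * x j ≤ 0)) :
    (arr7.face x).IsSimplicial := by
  rcases hx with hx | hx
  · exact h.isSimplicial fun k => by rw [inner_normal7]; exact hx k
  · refine h.neg.isSimplicial fun k => ?_
    rw [inner_normal7]
    have := hx k
    push_cast
    linarith

theorem arr7_isSimplicial : arr7.IsSimplicial := by
  rintro _ ⟨x, rfl⟩
  have key := @isSimplicial_of_data x
  have k0 := key ![0, 1, 2] ![1, 1, 1]
    ![![1, 0, 0], ![0, 1, 0], ![0, 0, 1]] (by decide)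
  have k1 := key ![0, 1, 6] ![1, 1, -1]
    ![![1, 0, -1], ![0, 1, -1], ![0, 0, -1]] (by decide)
  have k2 := key ![0, 2, 6] ![1, 1, -1]
    ![![1, -1, 0], ![0, -1, 1], ![0, -1, 0]] (by decide)
  have k3 := key ![0, 3, 4] ![1, -1, 1]
    ![![1, -1, 1], ![0, -1, 1], ![0, 0, 1]] (by decide)
  have k4 := key ![0, 3, 5] ![1, -1, -1]
    ![![1, -1, -1], ![0, -1, 0], ![0, 0, -1]] (by decide)
  have k5 := key ![0, 4, 5] ![1, 1, -1]
    ![![1, 1, -1], ![0, 1, 0], ![0, 1, -1]] (by decide)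
  have k6 := key ![1, 2, 6] ![1, 1, -1]
    ![![-1, 1, 0], ![-1, 0, 1], ![-1, 0, 0]] (by decide)
  have k7 := key ![1, 3, 4] ![1, -1, -1]
    ![![-1, 1, -1], ![-1, 0, 0], ![0, 0, -1]] (by decide)
  have k8 := key ![1, 3, 5] ![1, -1, 1]
    ![![-1, 1, 1], ![-1, 0, 1], ![0, 0, 1]] (by decide)
  have k9 := key ![1, 4, 5] ![1, -1, 1]
    ![![1, 1, -1], ![1, 0, -1], ![1, 0, 0]] (by decide)
  have k10 := key ![2, 3, 4] ![1, 1, -1]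
    ![![1, -1, 1], ![1, 0, 0], ![1, -1, 0]] (by decide)
  have k11 := key ![2, 3, 5] ![1, 1, -1]
    ![![-1, 1, 1], ![0, 1, 0], ![-1, 1, 0]] (by decide)
  have k12 := key ![2, 4, 5] ![1, -1, -1]
    ![![-1, -1, 1], ![0, -1, 0], ![-1, 0, 0]] (by decide)
  have k13 := key ![3, 4, 6] ![1, 1, -1]
    ![![0, 1, -1], ![-1, 1, 0], ![-1, 1, -1]] (by decide)
  have k14 := key ![3, 5, 6] ![1, 1, -1]
    ![![1, 0, -1], ![1, -1, 0], ![1, -1, -1]] (by decide)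
  have k15 := key ![4, 5, 6] ![1, 1, -1]
    ![![-1, 0, 1], ![0, -1, 1], ![-1, -1, 1]] (by decide)
  simp [normals7, Fin.forall_fin_succ, Fin.sum_univ_succ] at k0 k1 k2 k3 k4 k5 k6 k7 k8 k9 k10 k11 k12 k13 k14 k15
  rcases le_total 0 (x 0) with h0 | h0
  · rcases le_total 0 (x 1) with h1 | h1
    · rcases le_total 0 (x 2) with h2 | h2
      · exact k0 (Or.inl ⟨by linarith, by linarith, by linarith⟩)
      · rcases le_total 0 (x 0 + x 2) with h5 | h5
        · rcases le_total 0 (x 1 + x 2) with h4 | h4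
          · exact k12 (Or.inr ⟨by linarith, by linarith, by linarith⟩)
          · exact k9 (Or.inl ⟨by linarith, by linarith, by linarith⟩)
        · rcases le_total 0 (x 1 + x 2) with h4 | h4
          · exact k5 (Or.inl ⟨by linarith, by linarith, by linarith⟩)
          · rcases le_total 0 (x 0 + x 1 + x 2) with h6 | h6
            · exact k15 (Or.inr ⟨by linarith, by linarith, by linarith⟩)
            · exact k1 (Or.inl ⟨by linarith, by linarith, by linarith⟩)
    · rcases le_total 0 (x 2) with h2 | h2
      · rcases le_total 0 (x 0 + x 1) with h3 | h3
        · rcases le_total 0 (x 1 + x 2) with h4 | h4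
          · exact k7 (Or.inr ⟨by linarith, by linarith, by linarith⟩)
          · exact k10 (Or.inl ⟨by linarith, by linarith, by linarith⟩)
        · rcases le_total 0 (x 1 + x 2) with h4 | h4
          · exact k3 (Or.inl ⟨by linarith, by linarith, by linarith⟩)
          · rcases le_total 0 (x 0 + x 1 + x 2) with h6 | h6
            · exact k13 (Or.inr ⟨by linarith, by linarith, by linarith⟩)
            · exact k2 (Or.inl ⟨by linarith, by linarith, by linarith⟩)
      · rcases le_total 0 (x 0 + x 1) with h3 | h3
        · rcases le_total 0 (x 0 + x 2) with h5 | h5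
          · rcases le_total 0 (x 0 + x 1 + x 2) with h6 | h6
            · exact k6 (Or.inr ⟨by linarith, by linarith, by linarith⟩)
            · exact k14 (Or.inl ⟨by linarith, by linarith, by linarith⟩)
          · exact k8 (Or.inr ⟨by linarith, by linarith, by linarith⟩)
        · rcases le_total 0 (x 0 + x 2) with h5 | h5
          · exact k11 (Or.inr ⟨by linarith, by linarith, by linarith⟩)
          · exact k4 (Or.inl ⟨by linarith, by linarith, by linarith⟩)
  · rcases le_total 0 (x 1) with h1 | h1
    · rcases le_total 0 (x 2) with h2 | h2
      · rcases le_total 0 (x 0 + x 1) with h3 | h3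
        · rcases le_total 0 (x 0 + x 2) with h5 | h5
          · exact k4 (Or.inr ⟨by linarith, by linarith, by linarith⟩)
          · exact k11 (Or.inl ⟨by linarith, by linarith, by linarith⟩)
        · rcases le_total 0 (x 0 + x 2) with h5 | h5
          · exact k8 (Or.inl ⟨by linarith, by linarith, by linarith⟩)
          · rcases le_total 0 (x 0 + x 1 + x 2) with h6 | h6
            · exact k14 (Or.inr ⟨by linarith, by linarith, by linarith⟩)
            · exact k6 (Or.inl ⟨by linarith, by linarith, by linarith⟩)
      · rcases le_total 0 (x 0 + x 1) with h3 | h3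
        · rcases le_total 0 (x 1 + x 2) with h4 | h4
          · rcases le_total 0 (x 0 + x 1 + x 2) with h6 | h6
            · exact k2 (Or.inr ⟨by linarith, by linarith, by linarith⟩)
            · exact k13 (Or.inl ⟨by linarith, by linarith, by linarith⟩)
          · exact k3 (Or.inr ⟨by linarith, by linarith, by linarith⟩)
        · rcases le_total 0 (x 1 + x 2) with h4 | h4
          · exact k10 (Or.inr ⟨by linarith, by linarith, by linarith⟩)
          · exact k7 (Or.inl ⟨by linarith, by linarith, by linarith⟩)
    · rcases le_total 0 (x 2) with h2 | h2
      · rcases le_total 0 (x 0 + x 2) with h5 | h5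
        · rcases le_total 0 (x 1 + x 2) with h4 | h4
          · rcases le_total 0 (x 0 + x 1 + x 2) with h6 | h6
            · exact k1 (Or.inr ⟨by linarith, by linarith, by linarith⟩)
            · exact k15 (Or.inl ⟨by linarith, by linarith, by linarith⟩)
          · exact k5 (Or.inr ⟨by linarith, by linarith, by linarith⟩)
        · rcases le_total 0 (x 1 + x 2) with h4 | h4
          · exact k9 (Or.inr ⟨by linarith, by linarith, by linarith⟩)
          · exact k12 (Or.inl ⟨by linarith, by linarith, by linarith⟩)
      · exact k0 (Or.inr ⟨by linarith, by linarith, by linarith⟩)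

/-- The fan of the arrangement of seven hyperplanes. -/
def fan7 : Fan 3 := arr7.fan arr7_isSimplicial

/-- Its flat-partition. -/
def flatPartition7 : AdmissiblePartition fan7 := arr7.flatPartition arr7_isSimplicial

/-- Its poset of regions with base region `B`. -/
def regionPoset7 (B : fan7.Chamber) : FanPoset fan7 :=
  Arrangement.posetOfRegions arr7 (hA := arr7_isSimplicial) B

end PicGroup

end

/-!
The proof works for the flat-partition of any simplicial arrangement. With this partition the
generators of the picture group correspond to the hyperplanes, and every defining relation equates
two words in which each generator occurs equally often: a maximal chain from `a` down to `b` crosses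
exactly the hyperplanes in `sep B a \ sep B b`, each of them once (`crossings_chain`), and for an
inclusion `σ ⊆ κ` the set `sep B κ⁻ \ sep B σ⁻` consists of the hyperplanes through `σ` that have
`κ` strictly on the side opposite to `B`, which depends only on the span of `σ` and on `π_σ(κ)`
(`sepIndicator_lower_sub_eq`). Counting the occurrences of the `i`-th generator is therefore a
homomorphism from the picture group to `ℤ` (`crossingsHom`), with value
`[i ∈ sep B a] - [i ∈ sep B b]` on `X_{[b, a]}`.

Two parallel morphisms can be represented by inclusions `σ ⊆ κ₁` and `σ ⊆ κ₂` with a common source.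
If their images agree, these homomorphisms show that `κ₁⁻` and `κ₂⁻` have the same separating set.
Off the hyperplanes containing `κ₁` this set records on which side `κ₁` lies; since `κ₁` and `κ₂`
have the same span, they have the same sign vector and are equal.
-/

noncomputable section

namespace PicGroup

namespace Arrangement

variable {n : ℕ} {ι : Type} (A : Arrangement n ι)

/-! ### Separating sets along covers and at facial intervals -/

theorem finrank_hyperplane_add_one (i : ι) : Module.finrank ℝ (A.hyperplane i) + 1 = n := by
  have h := (Submodule.span ℝ {A.normal i}).finrank_add_finrank_orthogonal
  rw [finrank_span_singleton (A.normal_ne_zero i), finrank_euclideanSpace_fin] at h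
  rw [hyperplane]
  omega

theorem hyperplane_inj {i j : ι} : A.hyperplane i = A.hyperplane j ↔ i = j :=
  A.hyperplane_injective.eq_iff

variable [Finite ι] {hA : A.IsSimplicial}

theorem exists_eq_face (σ : (A.fan hA).Cone) : ∃ x, σ.1 = A.face x := by
  obtain ⟨_, x, rfl⟩ := σ
  exact ⟨x, rfl⟩

theorem support_cone (σ : (A.fan hA).Cone) : A.support σ.1 = cspan σ.1 := by
  obtain ⟨x, hx⟩ := A.exists_eq_face σ
  rw [hx, A.support_face]

/-- The intersection of two regions lies on every hyperplane that separates exactly one of them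
from the base region. -/
theorem cspan_inf_le_hyperplane {B a b : (A.fan hA).Chamber} {i : ι} (ha : i ∈ A.sep B a)
    (hb : i ∉ A.sep B b) : cspan (b.cone.1 ⊓ a.cone.1) ≤ A.hyperplane i := by
  obtain ⟨z, hz, rfl⟩ := A.exists_region B
  obtain ⟨x, hx, rfl⟩ := A.exists_region a
  obtain ⟨y, hy, rfl⟩ := A.exists_region b
  rw [A.mem_sep] at ha
  rw [A.not_mem_sep] at hb
  refine Submodule.span_le.2 ?_
  rintro w ⟨hwy, hwx⟩
  refine A.mem_hyperplane.2 ?_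
  have h1 := (A.mem_face_regular hy).1 hwy i
  have h2 := (A.mem_face_regular hx).1 hwx i
  rcases mul_pos_iff.1 hb with ⟨h3, h4⟩ | ⟨h3, h4⟩
  · exact le_antisymm (nonpos_of_mul_nonneg_left h2 (neg_of_mul_neg_left ha h4.le))
      (nonneg_of_mul_nonneg_left h1 h3)
  · exact le_antisymm (nonpos_of_mul_nonneg_left h1 h3)
      (nonneg_of_mul_nonneg_left h2 (pos_of_mul_neg_left ha h4.le))

/-- The label of an arrow `a → b` spans the unique hyperplane in `sep B a \ sep B b`. -/
theorem support_label_eq_iff {B a b : (A.fan hA).Chamber} (h : (A.posetOfRegions B).Arrow a b)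
    (i : ι) : A.support ((A.posetOfRegions B).label h).1.1 = A.hyperplane i ↔
      i ∈ A.sep B a ∧ i ∉ A.sep B b := by
  rw [support_cone]
  change cspan (b.cone.1 ⊓ a.cone.1) = A.hyperplane i ↔ _
  have hdim : cdim (b.cone.1 ⊓ a.cone.1) + 1 = n := (A.posetOfRegions B).covers_dim b a h
  have key : ∀ j, j ∈ A.sep B a → j ∉ A.sep B b →
      cspan (b.cone.1 ⊓ a.cone.1) = A.hyperplane j := by
    intro j h1 h2
    refine Submodule.eq_of_le_of_finrank_eq (A.cspan_inf_le_hyperplane h1 h2) ?_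
    have := A.finrank_hyperplane_add_one j
    rw [cdim] at hdim
    omega
  refine ⟨fun e => ?_, fun e => key i e.1 e.2⟩
  have hlt : (A.regionOrder B).lt b a := by
    let _ := A.regionOrder B
    exact CovBy.lt h
  obtain ⟨j, h1, h2⟩ := Set.not_subset.1 ((A.regionOrder B).lt_iff_le_not_ge _ _ |>.1 hlt).2
  obtain rfl := A.hyperplane_inj.1 ((key j h1 h2).symm.trans e)
  exact ⟨h1, h2⟩

theorem sep_subset_of_arrow {B a b : (A.fan hA).Chamber} (h : (A.posetOfRegions B).Arrow a b) :
    A.sep B b ⊆ A.sep B a := by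
  let _ := A.regionOrder B
  exact CovBy.le (a := b) (b := a) h

/-- The separating set of `σ⁻` consists of the hyperplanes that separate `σ` strictly from the
base region. -/
theorem mem_sep_lower_iff {b s : E n} (hb : ∀ i, inner ℝ (A.normal i) b ≠ 0)
    {σ : (A.fan hA).Cone} (hσ : σ.1 = A.face s) (i : ι) :
    i ∈ A.sep (A.region hA b hb) ((A.posetOfRegions (A.region hA b hb)).lower σ) ↔
      inner ℝ (A.normal i) s * inner ℝ (A.normal i) b < 0 := by
  obtain ⟨hi, hle, H⟩ := (A.posetOfRegions (A.region hA b hb)).lower_le_iff σ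
  have hlow := (H _).2 ⟨(A.regionOrder (A.region hA b hb)).le_refl _, hle⟩
  obtain ⟨l, hl⟩ := A.exists_push hb s
  have hl0 := fun i => (hl i).1
  have hσl : σ ≤ (A.region hA l hl0).cone := by
    change σ.1 ≤ A.face l
    rw [hσ]
    exact A.face_le (A.mem_face_of_push fun i => ⟨(hl i).1, (hl i).2.1, (hl i).2.2.1⟩)
  have hpush := ((H _).1 hσl).1
  have hpush' : i ∈ A.sep (A.region hA b hb)
      ((A.posetOfRegions (A.region hA b hb)).lower σ) →
      inner ℝ (A.normal i) l * inner ℝ (A.normal i) b < 0 :=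
    fun h => (A.mem_sep hb hl0).1 (hpush h)
  revert hlow hpush'
  obtain ⟨r, hr, e⟩ := A.exists_region
    ((A.posetOfRegions (A.region hA b hb)).lower σ)
  rw [e, A.mem_sep]
  intro hlow hpush'
  have hsσ : s ∈ σ.1 := hσ ▸ A.self_mem_face s
  have hsr := (A.mem_face_regular hr).1 (hlow hsσ) i
  rcases lt_trichotomy (inner ℝ (A.normal i) s) 0 with h0 | h0 | h0
  · have h1 := lt_of_le_of_ne (nonpos_of_mul_nonneg_right hsr h0) (hr i)
    rw [mul_neg_iff, mul_neg_iff]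
    simp [h0, h1, h0.not_gt, h1.not_gt]
  · have h1 := (hl i).2.2.2 h0
    simp only [h0, zero_mul, lt_irrefl, iff_false]
    exact fun h => (hpush' h).not_gt h1
  · have h1 := lt_of_le_of_ne (nonneg_of_mul_nonneg_right hsr h0) (hr i).symm
    rw [mul_neg_iff, mul_neg_iff]
    simp [h0, h1, h0.not_gt, h1.not_gt]

/-! ### Counting crossings of a hyperplane -/

open Classical in
/-- The indicator of the condition that the `i`-th hyperplane separates `R` from `B`. -/
def sepIndicator (B : (A.fan hA).Chamber) (i : ι) (R : (A.fan hA).Chamber) : ℤ :=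
  if i ∈ A.sep B R then 1 else 0

theorem sepIndicator_eq_iff {B R S : (A.fan hA).Chamber} {i : ι} :
    A.sepIndicator B i R = A.sepIndicator B i S ↔ (i ∈ A.sep B R ↔ i ∈ A.sep B S) := by
  unfold sepIndicator
  split_ifs with h1 h2 h2 <;> simp [h1, h2]

/-- The flat attached to a block of the flat-partition. -/
def blockSupport (a : (A.flatPartition hA).Obj) : Submodule ℝ (E n) :=
  Quotient.lift (s := (A.flatPartition hA).rel) (fun σ => A.support σ.1) (fun _ _ h => h) a

open Classical in
/-- The weight of a generator of the picture group: `1` if it is attached to the `i`-th hyperplane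
and `0` otherwise. -/
def crossingWeight (hA : A.IsSimplicial) (i : ι) (g : Gen (A.flatPartition hA)) :
    Multiplicative ℤ :=
  Multiplicative.ofAdd (if A.blockSupport g.1 = A.hyperplane i then 1 else 0)

/-- The homomorphism on the free group that counts, with signs, the occurrences of the generator
attached to the `i`-th hyperplane. -/
def crossings (hA : A.IsSimplicial) (i : ι) :
    FreeGroup (Gen (A.flatPartition hA)) →* Multiplicative ℤ :=
  FreeGroup.lift (A.crossingWeight hA i)

theorem crossings_word_cons (i : ι) {B a b : (A.fan hA).Chamber}
    (h : (A.posetOfRegions B).Arrow a b) (w : List (A.fan hA).Wall) :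
    A.crossings hA i (word (A.flatPartition hA) ((A.posetOfRegions B).label h :: w)) =
      Multiplicative.ofAdd (A.sepIndicator B i a - A.sepIndicator B i b) *
        A.crossings hA i (word (A.flatPartition hA) w) := by
  classical
  refine (map_mul (A.crossings hA i) _ _).trans ?_
  congr 1
  refine FreeGroup.lift_apply_of.trans (congrArg Multiplicative.ofAdd ?_)
  change (if A.support ((A.posetOfRegions B).label h).1.1 = A.hyperplane i then (1 : ℤ) else 0) = _
  have hsub : i ∈ A.sep B b → i ∈ A.sep B a := fun h' => A.sep_subset_of_arrow h h'
  simp only [A.support_label_eq_iff h i, sepIndicator]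
  by_cases h1 : i ∈ A.sep B a <;> by_cases h2 : i ∈ A.sep B b <;> simp_all

/-- The number of times a maximal chain from `a` down to `b` crosses the `i`-th hyperplane depends
only on `a` and `b`. -/
theorem crossings_chain (i : ι) {B a b : (A.fan hA).Chamber} {w : List (A.fan hA).Wall}
    (h : (A.posetOfRegions B).Chain a b w) :
    A.crossings hA i (word (A.flatPartition hA) w) =
      Multiplicative.ofAdd (A.sepIndicator B i a - A.sepIndicator B i b) := by
  induction h with
  | nil => rw [sub_self]; exact map_one _
  | cons h _ ih => rw [crossings_word_cons, ih, ← ofAdd_add, sub_add_sub_cancel]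

/-- Of two cones with the same image under `π_σ`, the second lies strictly opposite to `b` with
respect to a hyperplane through `σ` if the first does. -/
theorem mul_neg_of_proj_eq {s₁ s₂ k₁ k₂ : E n} {i : ι} {b : ℝ}
    (hσ : cspan (A.face s₁) = cspan (A.face s₂))
    (hp : proj (A.face s₁) (A.face k₁) = proj (A.face s₂) (A.face k₂))
    (h0 : inner ℝ (A.normal i) s₂ = 0) (h : inner ℝ (A.normal i) k₁ * b < 0) :
    inner ℝ (A.normal i) k₂ * b < 0 := by
  obtain ⟨y, hy, hky⟩ := ((proj_eq_iff hσ _ _).1 hp).1 k₁ (A.self_mem_face k₁)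
  have e := A.mem_cspan_face.1 hky i h0
  rw [inner_sub_right, sub_eq_zero] at e
  rw [e] at h
  obtain ⟨y1, y2, y3⟩ := hy i
  rcases lt_trichotomy (inner ℝ (A.normal i) k₂) 0 with h1 | h1 | h1
  · have := y3 h1
    exact mul_neg_of_neg_of_pos h1 (pos_of_mul_neg_right h this)
  · rw [y1 h1, zero_mul] at h
    exact absurd h (lt_irrefl 0)
  · have := y2 h1
    exact mul_neg_of_pos_of_neg h1 (neg_of_mul_neg_right h this)

/-- Equivalent inclusions `f_{σ κ}` cross the same hyperplanes between `σ⁻` and `κ⁻`. -/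
theorem sepIndicator_lower_sub_eq (B : (A.fan hA).Chamber) (i : ι) {σ₁ κ₁ σ₂ κ₂ : (A.fan hA).Cone}
    (h₁ : σ₁ ≤ κ₁) (h₂ : σ₂ ≤ κ₂) (hσ : (A.flatPartition hA).rel σ₁ σ₂)
    (hp : proj σ₁.1 κ₁.1 = proj σ₂.1 κ₂.1) :
    A.sepIndicator B i ((A.posetOfRegions B).lower κ₁) -
        A.sepIndicator B i ((A.posetOfRegions B).lower σ₁) =
      A.sepIndicator B i ((A.posetOfRegions B).lower κ₂) -
        A.sepIndicator B i ((A.posetOfRegions B).lower σ₂) := by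
  have hspan := (A.flatPartition hA).cspan_eq hσ
  obtain ⟨b, hb, rfl⟩ := A.exists_region B
  change σ₁.1 ≤ κ₁.1 at h₁
  change σ₂.1 ≤ κ₂.1 at h₂
  obtain ⟨s₁, hs₁⟩ := A.exists_eq_face σ₁
  obtain ⟨s₂, hs₂⟩ := A.exists_eq_face σ₂
  obtain ⟨k₁, hk₁⟩ := A.exists_eq_face κ₁
  obtain ⟨k₂, hk₂⟩ := A.exists_eq_face κ₂
  rw [hs₁, hk₁] at h₁
  rw [hs₂, hk₂] at h₂
  rw [hs₁, hs₂] at hspan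
  rw [hs₁, hs₂, hk₁, hk₂] at hp
  have hz := A.zero_iff_of_cspan_eq hspan i
  by_cases h0 : inner ℝ (A.normal i) s₁ = 0
  · congr 1
    · rw [sepIndicator_eq_iff, A.mem_sep_lower_iff hb hk₁, A.mem_sep_lower_iff hb hk₂]
      exact ⟨A.mul_neg_of_proj_eq hspan hp (hz.1 h0),
        A.mul_neg_of_proj_eq hspan.symm hp.symm h0⟩
    · rw [sepIndicator_eq_iff, A.mem_sep_lower_iff hb hs₁,
        A.mem_sep_lower_iff hb hs₂, h0, hz.1 h0]
  · -- off the hyperplane, `σ` and `κ` lie on the same side, so both differences vanish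
    have key : ∀ s k : E n, A.face s ≤ A.face k → inner ℝ (A.normal i) s ≠ 0 →
        (inner ℝ (A.normal i) k * inner ℝ (A.normal i) b < 0 ↔
          inner ℝ (A.normal i) s * inner ℝ (A.normal i) b < 0) := by
      intro s k h hs
      obtain ⟨y1, y2, y3⟩ := h (A.self_mem_face s) i
      rcases lt_trichotomy (inner ℝ (A.normal i) k) 0 with h1 | h1 | h1
      · have := lt_of_le_of_ne (y3 h1) hs
        simp [mul_neg_iff, h1, this, h1.not_gt, this.not_gt]
      · exact absurd (y1 h1) hs
      · have := lt_of_le_of_ne (y2 h1) hs.symm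
        simp [mul_neg_iff, h1, this, h1.not_gt, this.not_gt]
    rw [sub_eq_zero.2, sub_eq_zero.2]
    · rw [sepIndicator_eq_iff, A.mem_sep_lower_iff hb hk₂, A.mem_sep_lower_iff hb hs₂]
      exact key _ _ h₂ fun e => h0 (hz.2 e)
    · rw [sepIndicator_eq_iff, A.mem_sep_lower_iff hb hk₁, A.mem_sep_lower_iff hb hs₁]
      exact key _ _ h₁ h0

theorem crossings_eq_of_pictureRel (B : (A.fan hA).Chamber) (i : ι)
    {x y : FreeGroup (Gen (A.flatPartition hA))}
    (h : PictureRel (A.flatPartition hA) (A.posetOfRegions B) x y) :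
    A.crossings hA i x = A.crossings hA i y := by
  cases h with
  | chains hv hw => rw [A.crossings_chain i hv, A.crossings_chain i hw]
  | homs h₁ h₂ hσ _ hf hv hw =>
    rw [A.crossings_chain i hv, A.crossings_chain i hw,
      A.sepIndicator_lower_sub_eq B i h₁ h₂ hσ hf]

/-- The homomorphism from the picture group to `ℤ` that counts the occurrences of the generator
attached to the `i`-th hyperplane. -/
def crossingsHom (B : (A.fan hA).Chamber) (i : ι) :
    PictureGroup (A.flatPartition hA) (A.posetOfRegions B) →* Multiplicative ℤ :=
  PresentedGroup.toGroup (f := A.crossingWeight hA i) <| by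
    rintro _ ⟨x, y, h, rfl⟩
    change A.crossings hA i (x * y⁻¹) = 1
    rw [map_mul, map_inv, A.crossings_eq_of_pictureRel B i h, mul_inv_cancel]

theorem crossingsHom_wordElt (B : (A.fan hA).Chamber) (i : ι) (w : List (A.fan hA).Wall) :
    A.crossingsHom B i (wordElt (A.flatPartition hA) (A.posetOfRegions B) w) =
      A.crossings hA i (word (A.flatPartition hA) w) :=
  rfl

theorem crossingsHom_pathElt {B a b : (A.fan hA).Chamber} (i : ι)
    (h : (A.posetOfRegions B).le b a) :
    A.crossingsHom B i (pathElt (A.flatPartition hA) (A.posetOfRegions B) h) =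
      Multiplicative.ofAdd (A.sepIndicator B i a - A.sepIndicator B i b) := by
  obtain ⟨w, hw⟩ := (A.posetOfRegions B).exists_chain h
  rw [pathElt_eq _ _ h hw, crossingsHom_wordElt, A.crossings_chain i hw]

/-! ### Faithfulness -/

/-- A cone of the arrangement is determined by its span and the separating set of the least region
containing it. -/
theorem cone_eq_of_sep_lower_eq (B : (A.fan hA).Chamber) {κ₁ κ₂ : (A.fan hA).Cone}
    (hκ : (A.flatPartition hA).rel κ₁ κ₂)
    (h : ∀ i, i ∈ A.sep B ((A.posetOfRegions B).lower κ₁) ↔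
      i ∈ A.sep B ((A.posetOfRegions B).lower κ₂)) : κ₁ = κ₂ := by
  have hspan := (A.flatPartition hA).cspan_eq hκ
  obtain ⟨b, hb, rfl⟩ := A.exists_region B
  obtain ⟨k₁, hk₁⟩ := A.exists_eq_face κ₁
  obtain ⟨k₂, hk₂⟩ := A.exists_eq_face κ₂
  rw [hk₁, hk₂] at hspan
  refine Subtype.ext ?_
  rw [hk₁, hk₂]
  refine A.face_eq_of_sign fun i => ?_
  have hz := A.zero_iff_of_cspan_eq hspan i
  have hi := h i
  rw [A.mem_sep_lower_iff hb hk₁, A.mem_sep_lower_iff hb hk₂] at hi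
  rcases (hb i).lt_or_gt with hbi | hbi
  · rw [mul_neg_iff, mul_neg_iff] at hi
    simp only [hbi, hbi.not_gt, and_true, and_false, or_false] at hi
    simp only [sign_apply, hi]
    split_ifs with h1 h2 h3 h3 <;> first | rfl | grind
  · rw [mul_neg_iff, mul_neg_iff] at hi
    simp only [hbi, hbi.not_gt, and_true, and_false, false_or] at hi
    simp only [sign_apply, hi]
    split_ifs <;> first | rfl | grind

/-- For every simplicial arrangement and every base region, the functor from the category of the
flat-partition to the picture group is faithful. -/
theorem pictureFunctor_faithful (B : (A.fan hA).Chamber) :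
    (pictureFunctor (A.flatPartition hA) (A.posetOfRegions B)).Faithful where
  map_injective := by
    intro a c f g
    refine Quotient.inductionOn₂ f g fun f g h => ?_
    -- represent `g` by an inclusion with the same source as `f`
    obtain ⟨κ, hκ, hp⟩ := (A.flatPartition hA).exists_lift (f.src_rel g) g.le
    have hblock : (A.flatPartition hA).rel κ g.tgt :=
      (A.flatPartition hA).admissible _ _ _ _ (f.src_rel g) hκ g.le hp
    let g' : (A.flatPartition hA).PreHom a c :=
      ⟨f.src, κ, hκ, f.src_mem, ((A.flatPartition hA).block_eq_iff.2 hblock).trans g.tgt_mem⟩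
    have hg : g' ≈ g := hp
    have h' : preHomElt _ (A.posetOfRegions B) f = preHomElt _ (A.posetOfRegions B) g' :=
      Eq.trans h (preHomElt_eq _ _ _ _ hg).symm
    have htgt : f.tgt = κ := by
      refine A.cone_eq_of_sep_lower_eq B (f.tgt_rel g') fun i => ?_
      have e := congrArg (A.crossingsHom B i) h'
      rw [preHomElt, preHomElt, crossingsHom_pathElt, crossingsHom_pathElt] at e
      exact A.sepIndicator_eq_iff.1 (sub_left_injective (Multiplicative.ofAdd.injective e))
    refine Quotient.sound (Setoid.trans ?_ hg)
    change proj f.src.1 f.tgt.1 = proj f.src.1 κ.1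
    rw [htgt]

end Arrangement

end PicGroup

end

theorem mainTheorem7 (B : PicGroup.fan7.Chamber) :
    (PicGroup.pictureFunctor PicGroup.flatPartition7 (PicGroup.regionPoset7 B)).Faithful :=
  PicGroup.arr7.pictureFunctor_faithful (hA := PicGroup.arr7_isSimplicial) B
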